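/- Let $g$ be a nonnegative integer and let $a=(a_1,\dots,a_g)$, $x=(x_1,\dots,x_g)$ be non-commuting variables. Let $\mathbb R\langle a,x\rangle$ be the algebra of real non-commutative polynomials in them, with the linear involution ${}^T$ that reverses words and fixes each $a_j$ and $x_j$; $p$ is symmetric if $p^T=p$, and a square matrix polynomial $M=(M_{ij})$ is symmetric if $M_{ji}=M_{ij}^T$. Polynomials are evaluated at tuples of real symmetric $n\times n$ matrices, $n$ arbitrary, and a $k\times k$ matrix polynomial $M(a)$ at such a tuple $A$ is the block matrix $(M_{ij}(A))_{i,j}$ of size $kn\times kn$. Write $P\succeq0$ if $P$ is symmetric positive semidefinite, and write $\|A\|<1$ if $A$ is a $g$-tuple of real symmetric $n\times n$ matrices such that $I_n-\sum_j A_j^2$ is positive definite. Let $p\in\mathbb R\langle a,x\rangle$ be symmetric. Consider the following conditions, each for all sizes $n$, where $A,B,X,Y$ range over $g$-tuples of real symmetric $n\times n$ matrices and $0<t<1$. (i) $p$ is convex in $x$ for $\|a\|<1$: $t\,p(A,X)+(1-t)\,p(A,Y)-p(A,tX+(1-t)Y)\succeq0$ whenever $\|A\|<1$, for all $X,Y$.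 (ii) $p(A,X)\succeq0$ whenever $\|A\|<1$, for all $X$. (iii) $p$ is concave in $a$: $p(tA+(1-t)B,X)-t\,p(A,X)-(1-t)\,p(B,X)\succeq0$ for all $A,B,X$. If (i), (ii) and (iii) hold, then there are $(g+1)\times(g+1)$ matrices $R(a)$, $Q(a)$ of polynomials in $a$ such that $$p(a,x)=W(x)^T\bigl(R(a)-Q(a)\bigr)W(x),$$ where (a) $W(x)$ is the column vector with entries $1,x_1,\dots,x_g$; (b) $R$ and $Q$ are symmetric; (c) every entry of $R$ has degree at most one; (d) every entry of $Q$ is homogeneous of degree two, and $Q(A)\succeq0$ for every $g$-tuple $A$ of real symmetric matrices of any common size; (e) $R(A)-Q(A)\succeq0$ whenever $\|A\|<1$; and, moreover, $Q$ is a sum of squares: $Q=S^TS$ for some matrix $S(a)$ of polynomials in $a$ with finitely many rows and $g+1$ columns, where $(S^T)_{ij}=S_{ji}^T$. Conversely, if $p=W(x)^T(R(a)-Q(a))W(x)$ with $W,R,Q$ satisfying (a)-(e), then $p$ satisfies (i), (ii) and (iii). -/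

import Mathlib

open scoped Matrix

namespace NCPoly

/-- Non-commutative real polynomials in the letters `σ`. Mathlib's `star` on the free algebra is the
involution that reverses words and fixes every letter and every real scalar, so `IsSelfAdjoint p`
says that `p` is symmetric. -/
abbrev Poly (σ : Type) : Type := FreeAlgebra ℝ σ

/-- Polynomials `p(a, x)`: the letter `a_j` is `Sum.inl j`, the letter `x_j` is `Sum.inr j`. -/
abbrev PolyAX (g : ℕ) : Type := Poly (Fin g ⊕ Fin g)

/-- The word `y_{j₁} y_{j₂} ⋯ y_{jₘ}` as a polynomial. -/
def word {σ : Type} (w : List σ) : Poly σ := (w.map (FreeAlgebra.ι ℝ)).prod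

/-- `q` is a linear combination of words of length at most `d`. -/
def DegreeLE {σ : Type} (d : ℕ) (q : Poly σ) : Prop :=
  q ∈ Submodule.span ℝ {m : Poly σ | ∃ w : List σ, w.length ≤ d ∧ m = word w}

/-- `q` is a linear combination of words of length exactly `d`. -/
def Homogeneous {σ : Type} (d : ℕ) (q : Poly σ) : Prop :=
  q ∈ Submodule.span ℝ {m : Poly σ | ∃ w : List σ, w.length = d ∧ m = word w}

/-- Tuples of real `n × n` matrices indexed by `σ`. -/
abbrev Tuple (σ : Type) (n : ℕ) : Type := σ → Matrix (Fin n) (Fin n) ℝ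

/-- The set of `g`-tuples of real symmetric `n × n` matrices. -/
def symTuples (g n : ℕ) : Set (Tuple (Fin g) n) := {Y | ∀ j, (Y j).IsSymm}

/-- Evaluation of a polynomial at a tuple of matrices. -/
noncomputable def eval {σ : Type} {n : ℕ} (Y : Tuple σ n) : Poly σ →ₐ[ℝ] Matrix (Fin n) (Fin n) ℝ :=
  FreeAlgebra.lift ℝ Y

/-- The value `p(A, X)`. -/
noncomputable def evalAX {g n : ℕ} (p : PolyAX g) (A X : Tuple (Fin g) n) :
    Matrix (Fin n) (Fin n) ℝ :=
  eval (Sum.elim A X) p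

/-- The value at `A` of a `k × k` matrix of polynomials in `a`, a `k × k` block matrix with blocks of
size `n × n`. -/
noncomputable def evalMat {g k n : ℕ} (M : Matrix (Fin k) (Fin k) (Poly (Fin g)))
    (A : Tuple (Fin g) n) : Matrix (Fin k × Fin n) (Fin k × Fin n) ℝ :=
  Matrix.comp (Fin k) (Fin k) (Fin n) (Fin n) ℝ (M.map (eval A))

/-- The domain `‖a‖ < 1`: tuples `A` of symmetric matrices with `∑ A_j² ≺ I`. -/
def unitBall (g n : ℕ) : Set (Tuple (Fin g) n) :=
  {A | A ∈ symTuples g n ∧ (1 - ∑ j, A j * A j).PosDef}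

/-- `p` is convex in `x` for `‖a‖ < 1`, in every matrix size. -/
def ConvexInXOnBall {g : ℕ} (p : PolyAX g) : Prop :=
  ∀ n : ℕ, ∀ A ∈ unitBall g n, ∀ X ∈ symTuples g n, ∀ Y ∈ symTuples g n,
    ∀ t : ℝ, 0 < t → t < 1 →
      (t • evalAX p A X + (1 - t) • evalAX p A Y - evalAX p A (t • X + (1 - t) • Y)).PosSemidef

/-- `p(A, X) ⪰ 0` for `‖A‖ < 1` and all `X`, in every matrix size. -/
def NonnegOnBall {g : ℕ} (p : PolyAX g) : Prop :=
  ∀ n : ℕ, ∀ A ∈ unitBall g n, ∀ X ∈ symTuples g n, (evalAX p A X).PosSemidef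

/-- `p` is (globally) concave in `a`, in every matrix size. -/
def ConcaveInA {g : ℕ} (p : PolyAX g) : Prop :=
  ∀ n : ℕ, ∀ A ∈ symTuples g n, ∀ B ∈ symTuples g n, ∀ X ∈ symTuples g n,
    ∀ t : ℝ, 0 < t → t < 1 →
      (evalAX p (t • A + (1 - t) • B) X - (t • evalAX p A X + (1 - t) • evalAX p B X)).PosSemidef

/-- A polynomial in `a` alone, regarded as a polynomial in `(a, x)`. -/
noncomputable def ofA (g : ℕ) : Poly (Fin g) →ₐ[ℝ] PolyAX g :=
  FreeAlgebra.lift ℝ fun j => FreeAlgebra.ι ℝ (Sum.inl j)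

/-- The column vector `W(x) = (1, x_1, …, x_g)`. -/
noncomputable def W (g : ℕ) : Fin (g + 1) → PolyAX g :=
  Fin.cons 1 fun j => FreeAlgebra.ι ℝ (Sum.inr j)

/-- The polynomial `W(x)ᵀ M(a) W(x)`. -/
noncomputable def sandwich {g : ℕ} (M : Matrix (Fin (g + 1)) (Fin (g + 1)) (Poly (Fin g))) :
    PolyAX g :=
  ∑ i, ∑ j, star (W g i) * ofA g (M i j) * W g j

/-- `p = W(x)ᵀ (R(a) - Q(a)) W(x)`, where `R` and `Q` are symmetric matrix polynomials, `R` has degree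
at most one, `Q` is homogeneous of degree two with `Q(A) ⪰ 0` for every tuple `A` of symmetric
matrices of any size, and `R(A) - Q(A) ⪰ 0` for `‖A‖ < 1`. -/
structure IsRepresentation {g : ℕ} (p : PolyAX g)
    (R Q : Matrix (Fin (g + 1)) (Fin (g + 1)) (Poly (Fin g))) : Prop where
  eq_sandwich : p = sandwich (R - Q)
  symm_R : R.IsHermitian
  symm_Q : Q.IsHermitian
  degree_R : ∀ i j, DegreeLE 1 (R i j)
  homogeneous_Q : ∀ i j, Homogeneous 2 (Q i j)
  nonneg_Q : ∀ n : ℕ, ∀ A ∈ symTuples g n, (evalMat Q A).PosSemidef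
  nonneg_sub : ∀ n : ℕ, ∀ A ∈ unitBall g n, (evalMat R A - evalMat Q A).PosSemidef

/-- `Q(a)` is a sum of squares: `Q = Sᵀ S` for a matrix `S` of polynomials in `a` (`ᴴ` transposes the
matrix and applies the involution to the entries). -/
def IsSumOfSquares {g k : ℕ} (Q : Matrix (Fin k) (Fin k) (Poly (Fin g))) : Prop :=
  ∃ (N : ℕ) (S : Matrix (Fin N) (Fin k) (Poly (Fin g))), Q = Sᴴ * S

end NCPoly

/-! The engine is a noncommutative Hessian argument. Perturb a direct sum `Y ⊕ Y'` in an
off-diagonal direction with corner blocks `K_i` and test on `ξ ⊕ 0`. The coefficient of `r²` in the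
value of `p` is a quadratic form in the vectors `K_j v(Y) ξ`; its matrix, the middle matrix, has
`((j,v),(i,u))` entry `∑ₘ c · m(Y')`, with `c` the coefficient in `p` of the word `vᵀ j m i u`. For
truncated Fock space operators `Y` and the vacuum `ξ`, the vectors `v(Y) ξ` with `v` short are
independent, so the `K_j v(Y) ξ` can be prescribed freely and the middle matrix at `Y'` is positive
semidefinite (`middle_nonneg`).

A vanishing diagonal entry of such a matrix kills its column (`LocallyConvex.coeff_eq_zero`). Hence
`p` has degree at most two in the letters in which it is convex or concave
(`LocallyConvex.countP_le_two`): here in `x` and in `a` separately. Convexity in `x` makes the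
coefficient of `a_k x_i x_i a_k` nonnegative; concavity in `a` at scalar `x` makes it nonpositive.
So it vanishes, and a word with two letters `x` must begin and end with them. Varying the scalar
also removes `a x a`. The remaining words are `W_α m(a) W_β` with `m` of length at most two
(`exists_eq_letterW_append`), and this yields `R` and `Q`.

The coefficients of `Q` form a Gram matrix that is part of the constant term of the middle matrix of
`-p`; factoring it gives the sum of squares. Positivity of `R - Q` follows from that of `p` because
the vectors `W(X) v` are dense (`posSemidef_evalMat_of_sandwich`). The converse is a computation
with quadratic forms: `W` is affine in `x`, `R` is affine in `a`, and the concavity defect of `-Q`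
is `t(1-t) Q(A - B)`. -/

namespace NCPoly

/-! ### Coefficients with respect to the basis of words -/

section Coefficients

variable {σ : Type}

@[simp] lemma word_nil : word ([] : List σ) = 1 := by simp [word]

@[simp] lemma word_cons (i : σ) (w : List σ) : word (i :: w) = FreeAlgebra.ι ℝ i * word w := by
  simp [word]

lemma word_append (v w : List σ) : word (v ++ w) = word v * word w := by
  simp [word]

lemma star_word (w : List σ) : star (word w) = word w.reverse := by
  induction w with
  | nil => simp
  | cons i w ih => simp [ih, word_append]

/-- The basis of words of the algebra of non-commutative polynomials. -/
noncomputable def wordBasis (σ : Type) : Module.Basis (List σ) ℝ (Poly σ) :=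
  (FreeAlgebra.basisFreeMonoid ℝ σ).reindex FreeMonoid.toList

lemma wordBasis_apply (w : List σ) : wordBasis σ w = word w := by
  simp [wordBasis, FreeAlgebra.basisFreeMonoid, FreeAlgebra.equivMonoidAlgebraFreeMonoid,
    MonoidAlgebra.lift_single, word, FreeMonoid.lift_apply]

/-- The coefficient of the word `w`. -/
noncomputable def coeff (p : Poly σ) (w : List σ) : ℝ := (wordBasis σ).repr p w

/-- The words that occur in `p`. -/
noncomputable def support (p : Poly σ) : Finset (List σ) := ((wordBasis σ).repr p).support

lemma mem_support {p : Poly σ} {w : List σ} : w ∈ support p ↔ coeff p w ≠ 0 :=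
  Finsupp.mem_support_iff

lemma coeff_add (p q : Poly σ) (w : List σ) : coeff (p + q) w = coeff p w + coeff q w := by
  simp [coeff]

lemma coeff_smul (r : ℝ) (p : Poly σ) (w : List σ) : coeff (r • p) w = r * coeff p w := by
  simp [coeff]

lemma coeff_neg (p : Poly σ) (w : List σ) : coeff (-p) w = -coeff p w := by
  simp [coeff]

lemma coeff_sum {ι : Type*} (s : Finset ι) (f : ι → Poly σ) (w : List σ) :
    coeff (∑ i ∈ s, f i) w = ∑ i ∈ s, coeff (f i) w := by
  simp [coeff, map_sum, Finsupp.finsetSum_apply]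

lemma coeff_word [DecidableEq σ] (v w : List σ) :
    coeff (word v) w = if v = w then 1 else 0 := by
  rw [coeff, ← wordBasis_apply, Module.Basis.repr_self, Finsupp.single_apply]

lemma ext_coeff {p q : Poly σ} (h : ∀ w, coeff p w = coeff q w) : p = q :=
  (wordBasis σ).repr.injective (Finsupp.ext h)

lemma sum_coeff_smul_word (p : Poly σ) : ∑ w ∈ support p, coeff p w • word w = p := by
  conv_rhs => rw [← (wordBasis σ).linearCombination_repr p]
  simp [Finsupp.linearCombination_apply, Finsupp.sum, support, coeff, wordBasis_apply]

lemma star_real_smul (r : ℝ) (q : Poly σ) : star (r • q) = r • star q := by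
  rw [Algebra.smul_def, star_mul, FreeAlgebra.star_algebraMap, Algebra.smul_def,
    Algebra.commutes]

lemma coeff_star (p : Poly σ) (w : List σ) : coeff (star p) w = coeff p w.reverse := by
  classical
  conv_lhs => rw [← sum_coeff_smul_word p]
  conv_rhs => rw [← sum_coeff_smul_word p]
  simp only [star_sum, coeff_sum, star_real_smul, coeff_smul, star_word, coeff_word]
  refine Finset.sum_congr rfl fun v _ => ?_
  congr 1
  simp [List.reverse_eq_iff]

lemma coeff_reverse {p : Poly σ} (hp : IsSelfAdjoint p) (w : List σ) :
    coeff p w.reverse = coeff p w := by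
  rw [← coeff_star, hp.star_eq]

lemma exists_degree_bound (p : Poly σ) : ∃ D : ℕ, ∀ w, coeff p w ≠ 0 → w.length ≤ D :=
  ⟨(support p).sup List.length, fun _ hw => Finset.le_sup (f := List.length) (mem_support.2 hw)⟩

end Coefficients

/-! ### Evaluation at symmetric matrices and the action of words on a vector -/

section Evaluation

lemma dotProduct_mulVec_of_isSymm {ι : Type} [Fintype ι] {A : Matrix ι ι ℝ} (hA : A.IsSymm) (x y : ι → ℝ) :
    (A *ᵥ x) ⬝ᵥ y = x ⬝ᵥ (A *ᵥ y) := by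
  rw [Matrix.dotProduct_mulVec, ← Matrix.mulVec_transpose, hA.eq]

variable {σ : Type} {ι κ : Type} [Fintype ι] [DecidableEq ι] [Fintype κ] [DecidableEq κ]

/-- Evaluation at matrices with rows and columns in an arbitrary finite type. -/
noncomputable def ev (Y : σ → Matrix ι ι ℝ) : Poly σ →ₐ[ℝ] Matrix ι ι ℝ := FreeAlgebra.lift ℝ Y

@[simp] lemma ev_ι (Y : σ → Matrix ι ι ℝ) (i : σ) : ev Y (FreeAlgebra.ι ℝ i) = Y i := by
  simp [ev]

lemma eval_eq_ev {n : ℕ} (Y : Tuple σ n) : eval Y = ev Y := rfl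

lemma transpose_ev {Y : σ → Matrix ι ι ℝ} (hY : ∀ i, (Y i).IsSymm) (p : Poly σ) :
    (ev Y p)ᵀ = ev Y (star p) := by
  induction p using FreeAlgebra.induction with
  | grade0 r => simp [FreeAlgebra.star_algebraMap, Matrix.algebraMap_eq_diagonal]
  | grade1 i => simpa using (hY i).eq
  | mul a b ha hb => simp [ha, hb]
  | add a b ha hb => simp [ha, hb]

lemma isHermitian_ev {Y : σ → Matrix ι ι ℝ} (hY : ∀ i, (Y i).IsSymm) {p : Poly σ}
    (hp : IsSelfAdjoint p) : (ev Y p).IsHermitian := by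
  rw [Matrix.IsHermitian, Matrix.conjTranspose_eq_transpose_of_trivial, transpose_ev hY,
    hp.star_eq]

lemma ev_reindex (e : ι ≃ κ) (Y : σ → Matrix ι ι ℝ) (p : Poly σ) :
    ev (fun i => (Y i).submatrix e.symm e.symm) p = (ev Y p).submatrix e.symm e.symm := by
  have : ev (fun i => (Y i).submatrix e.symm e.symm) =
      ((Matrix.reindexAlgEquiv ℝ ℝ e : Matrix ι ι ℝ →ₐ[ℝ] Matrix κ κ ℝ)).comp (ev Y) := by
    ext i : 2
    simp
  rw [this]
  simp

/-- The value of the word `w` at `Y`, applied to the vector `ξ`. -/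
noncomputable def act (Y : σ → Matrix ι ι ℝ) (ξ : ι → ℝ) (w : List σ) : ι → ℝ :=
  ev Y (word w) *ᵥ ξ

@[simp] lemma act_nil (Y : σ → Matrix ι ι ℝ) (ξ : ι → ℝ) : act Y ξ [] = ξ := by simp [act]

@[simp] lemma act_cons (Y : σ → Matrix ι ι ℝ) (ξ : ι → ℝ) (i : σ) (w : List σ) :
    act Y ξ (i :: w) = Y i *ᵥ act Y ξ w := by simp [act]

lemma ev_mulVec (Y : σ → Matrix ι ι ℝ) (ξ : ι → ℝ) (p : Poly σ) :
    ev Y p *ᵥ ξ = ∑ w ∈ support p, coeff p w • act Y ξ w := by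
  conv_lhs => rw [← sum_coeff_smul_word p]
  simp [Matrix.sum_mulVec, Matrix.smul_mulVec, act]

lemma act_smul (t : σ → ℝ) (Y : σ → Matrix ι ι ℝ) (ξ : ι → ℝ) (w : List σ) :
    act (fun i => t i • Y i) ξ w = (w.map t).prod • act Y ξ w := by
  induction w with
  | nil => simp
  | cons i w ih => simp [ih, Matrix.smul_mulVec, Matrix.mulVec_smul, smul_smul, mul_comm]

lemma act_dotProduct {Y : σ → Matrix ι ι ℝ} (hY : ∀ i, (Y i).IsSymm) (x y : ι → ℝ) (w : List σ) :
    act Y x w ⬝ᵥ y = x ⬝ᵥ act Y y w.reverse := by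
  rw [act, act, ← star_word, ← transpose_ev hY, Matrix.dotProduct_mulVec, Matrix.vecMul_transpose]

end Evaluation

/-! ### Truncated Fock space and dual vectors -/

section DualVectors

variable {σ : Type} [Fintype σ] [DecidableEq σ]

/-- Words of length at most `D`. -/
abbrev ShortWord (σ : Type) (D : ℕ) : Type := {w : List σ // w.length ≤ D}

noncomputable instance (D : ℕ) : Fintype (ShortWord σ D) :=
  (List.finite_length_le σ D).fintype

/-- The compression to words of length at most `D` of the sum of a creation operator and its
adjoint on the full Fock space. -/
def fock (σ : Type) [DecidableEq σ] (D : ℕ) (i : σ) :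
    Matrix (ShortWord σ D) (ShortWord σ D) ℝ :=
  Matrix.of fun u v => if u.1 = i :: v.1 ∨ v.1 = i :: u.1 then 1 else 0

omit [Fintype σ] in
lemma fock_isSymm (D : ℕ) (i : σ) : (fock σ D i).IsSymm := by
  ext u v
  simp [fock, or_comm]

/-- The empty word as a unit vector. -/
def vacuum (σ : Type) [DecidableEq σ] (D : ℕ) : ShortWord σ D → ℝ := Pi.single ⟨[], by simp⟩ 1

/-- Each letter changes the length by one, and only creation lengthens: applied to the vacuum, `v`
gives the basis vector of `v` plus basis vectors of strictly shorter words. With `act_fock_self`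
this is unitriangularity. -/
lemma act_fock_of_ne {D : ℕ} (v : List σ) :
    ∀ w : ShortWord σ D, v.length ≤ w.1.length → w.1 ≠ v →
      act (fock σ D) (vacuum σ D) v w = 0 := by
  induction v with
  | nil =>
    intro w _ hne
    have : w ≠ ⟨[], by simp⟩ := fun h => hne (by rw [h])
    simp [vacuum, this]
  | cons i v ih =>
    intro w hl hne
    simp only [act_cons, Matrix.mulVec, dotProduct, fock, Matrix.of_apply]
    refine Finset.sum_eq_zero fun u _ => ?_
    split_ifs with h
    · rw [one_mul]
      refine ih u ?_ ?_
      · rcases h with h | h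
        · have := congrArg List.length h
          simp only [List.length_cons] at this hl
          omega
        · have := congrArg List.length h
          simp only [List.length_cons] at this hl
          omega
      · rintro rfl
        rcases h with h | h
        · exact hne h
        · have := congrArg List.length h
          simp only [List.length_cons] at this hl
          omega
    · simp

lemma act_fock_self {D : ℕ} (v : List σ) (hv : v.length ≤ D) :
    act (fock σ D) (vacuum σ D) v ⟨v, hv⟩ = 1 := by
  induction v with
  | nil => simp [vacuum]
  | cons i v ih =>
    have hv' : v.length ≤ D := by
      simp only [List.length_cons] at hv
      omega
    simp only [act_cons, Matrix.mulVec, dotProduct]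
    rw [Finset.sum_eq_single ⟨v, hv'⟩]
    · simp [fock, ih hv']
    · intro u _ hu
      simp only [fock, Matrix.of_apply]
      split_ifs with h
      · rcases h with h | h
        · exact absurd (Subtype.ext (List.cons_injective h).symm) hu
        · rw [act_fock_of_ne v u, mul_zero]
          · rw [h]
            simp only [List.length_cons]
            omega
          · intro h'
            have := congrArg List.length (h'.symm.trans h)
            simp only [List.length_cons] at this
            omega
      · simp
    · simp

lemma linearIndependent_act_fock (D : ℕ) :
    LinearIndependent ℝ fun v : ShortWord σ D => act (fock σ D) (vacuum σ D) v.1 := by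
  rw [Fintype.linearIndependent_iff]
  intro c hc
  by_contra! hne
  -- At a longest word with nonzero coefficient, triangularity leaves only that word's own term.
  obtain ⟨v, hv, hmax⟩ := Finset.exists_max_image (Finset.univ.filter fun v => c v ≠ 0)
    (fun v : ShortWord σ D => v.1.length) (by simpa [Finset.filter_nonempty_iff] using hne)
  have h := congrFun hc v
  simp only [Finset.sum_apply, Pi.smul_apply, smul_eq_mul, Pi.zero_apply] at h
  rw [Finset.sum_eq_single v, act_fock_self v.1 v.2, mul_one] at h
  · exact (Finset.mem_filter.1 hv).2 h
  · intro u _ hu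
    by_cases hcu : c u = 0
    · simp [hcu]
    · rw [act_fock_of_ne u.1 v (hmax u (by simpa using hcu)) fun h => hu (Subtype.ext h.symm),
        mul_zero]
  · simp

/-- There are symmetric matrices `Y` and a vector `ξ` for which the vectors `w(Y) ξ`, for words `w`
of bounded length, admit a dual family. -/
lemma exists_dual_vectors (σ : Type) [Fintype σ] [DecidableEq σ] (D : ℕ) :
    ∃ φ : List σ → ShortWord σ D → ℝ, ∀ v w : List σ, v.length ≤ D → w.length ≤ D →
      φ w ⬝ᵥ act (fock σ D) (vacuum σ D) v = if v = w then 1 else 0 := by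
  have : Nonempty (ShortWord σ D) := ⟨⟨[], by simp⟩⟩
  -- There are as many vectors as dimensions, so they form a basis; `φ w` is its coordinate
  -- functional written as a vector.
  let b := basisOfLinearIndependentOfCardEqFinrank (linearIndependent_act_fock (σ := σ) D)
    (by simp)
  refine ⟨fun w => if h : w.length ≤ D then fun u => b.coord ⟨w, h⟩ (Pi.single u 1) else 0,
    fun v w hv hw => ?_⟩
  have hb : act (fock σ D) (vacuum σ D) v = b ⟨v, hv⟩ := by simp [b]
  have key := LinearMap.pi_apply_eq_sum_univ (b.coord ⟨w, hw⟩) (b ⟨v, hv⟩)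
  rw [Module.Basis.coord_apply, Module.Basis.repr_self, Finsupp.single_apply] at key
  simp only [Subtype.mk.injEq] at key
  rw [key, hb, dotProduct]
  simp only [dif_pos hw]
  refine Finset.sum_congr rfl fun u _ => ?_
  rw [smul_eq_mul, mul_comm]
  congr 3
  ext x
  simp [Pi.single_apply, eq_comm]

end DualVectors

/-! ### Second-order expansion and the middle matrix -/

section Hessian

variable {σ : Type} {ι κ : Type} [Fintype ι] [DecidableEq ι] [Fintype κ] [DecidableEq κ]

/-- The second differences of `p` at `Y` are positive semidefinite, in all small symmetric
directions supported on the letters in `T`. -/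
def SecondDiffNonneg (p : Poly σ) (T : Set σ) (Y : σ → Matrix ι ι ℝ) : Prop :=
  ∀ H : σ → Matrix ι ι ℝ, (∀ i, (H i).IsSymm) → (∀ i ∉ T, H i = 0) →
    ∃ δ > 0, ∀ r : ℝ, 0 < r → r < δ →
      (ev (fun i => Y i + r • H i) p + ev (fun i => Y i + (-r) • H i) p
        - (2 : ℝ) • ev Y p).PosSemidef

/-- The vector `∑ m(Y) η_{j,v}`, the sum over the factorizations `w = m j v`. -/
noncomputable def innerSum (Y : σ → Matrix κ κ ℝ) (η : σ → List σ → κ → ℝ) : List σ → κ → ℝ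
  | [] => 0
  | j :: v => Y j *ᵥ innerSum Y η v + η j v

/-- The sum `∑ ⟨ζ_{i,u}, m(Y) η_{j,v}⟩` over the factorizations `w = l i m j v`, where `u` is the
reversed word `l` followed by the first argument. -/
noncomputable def outerSum (Y : σ → Matrix κ κ ℝ) (ζ η : σ → List σ → κ → ℝ) :
    List σ → List σ → ℝ
  | _, [] => 0
  | u, i :: w => ζ i u ⬝ᵥ innerSum Y η w + outerSum Y ζ η (i :: u) w

/-- The bilinear form of the middle matrix of the Hessian of `p`. -/
noncomputable def middle (p : Poly σ) (Y : σ → Matrix κ κ ℝ) (ζ η : σ → List σ → κ → ℝ) : ℝ :=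
  ∑ w ∈ support p, coeff p w * outerSum Y ζ η [] w

/-- The coefficient of second order of `w(Y + r H) ξ`. -/
noncomputable def secondOrder (Y : σ → Matrix ι ι ℝ) (K : σ → Matrix κ ι ℝ)
    (e : List σ → κ → ℝ) : List σ → ι → ℝ
  | [] => 0
  | i :: w => Y i *ᵥ secondOrder Y K e w + (K i)ᵀ *ᵥ e w

/-- An off-diagonal direction exchanges the two summands, so reaching the lower block costs one
factor `r` and returning costs another. The remainders need only be continuous, since only the limit
`r → 0` is used. -/
lemma act_fromBlocks_expansion (Y : σ → Matrix ι ι ℝ) (Y' : σ → Matrix κ κ ℝ)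
    (K : σ → Matrix κ ι ℝ) (ξ : ι → ℝ) (w : List σ) :
    ∃ R₁ : ℝ → ι → ℝ, ∃ R₂ : ℝ → κ → ℝ, Continuous R₁ ∧ Continuous R₂ ∧ ∀ r : ℝ,
      act (fun i => Matrix.fromBlocks (Y i) 0 0 (Y' i) +
        r • Matrix.fromBlocks 0 (K i)ᵀ (K i) 0) (Sum.elim ξ 0) w =
      Sum.elim
        (act Y ξ w + r ^ 2 • secondOrder Y K (innerSum Y' fun j v => K j *ᵥ act Y ξ v) w
          + r ^ 3 • R₁ r)
        (r • innerSum Y' (fun j v => K j *ᵥ act Y ξ v) w + r ^ 2 • R₂ r) := by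
  induction w with
  | nil =>
    refine ⟨0, 0, continuous_const, continuous_const, fun r => ?_⟩
    simp [secondOrder, innerSum]
  | cons i w ih =>
    obtain ⟨R₁, R₂, h₁, h₂, h⟩ := ih
    set e := innerSum Y' fun j v => K j *ᵥ act Y ξ v with he
    refine ⟨fun r => Y i *ᵥ R₁ r + (K i)ᵀ *ᵥ R₂ r,
      fun r => Y' i *ᵥ R₂ r + r • (K i *ᵥ secondOrder Y K e w) + r ^ 2 • (K i *ᵥ R₁ r), ?_, ?_,
      fun r => ?_⟩
    · fun_prop
    · fun_prop
    · rw [act_cons, h r, Matrix.fromBlocks_smul, Matrix.fromBlocks_add,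
        Matrix.fromBlocks_mulVec]
      congr 1
      · simp only [Sum.elim_comp_inl, Sum.elim_comp_inr, smul_zero, add_zero, zero_add,
          Matrix.smul_mulVec, Matrix.mulVec_add, Matrix.mulVec_smul, secondOrder, act_cons]
        module
      · simp only [Sum.elim_comp_inl, Sum.elim_comp_inr, smul_zero, add_zero, zero_add,
          Matrix.smul_mulVec, Matrix.mulVec_add, Matrix.mulVec_smul, he, innerSum]
        module

omit [DecidableEq κ] in
lemma innerSum_congr (Y : σ → Matrix κ κ ℝ) {η η' : σ → List σ → κ → ℝ} {D : ℕ}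
    (h : ∀ j v, v.length < D → η j v = η' j v) (w : List σ) (hw : w.length ≤ D) :
    innerSum Y η w = innerSum Y η' w := by
  induction w with
  | nil => rfl
  | cons j v ih =>
    simp only [List.length_cons] at hw
    rw [innerSum, innerSum, ih (by omega), h j v (by omega)]

omit [DecidableEq κ] in
lemma outerSum_congr (Y : σ → Matrix κ κ ℝ) {η η' : σ → List σ → κ → ℝ} {D : ℕ}
    (h : ∀ j v, v.length < D → η j v = η' j v) (w u : List σ) (hw : u.length + w.length ≤ D) :
    outerSum Y η η u w = outerSum Y η' η' u w := by
  induction w generalizing u with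
  | nil => rfl
  | cons i w ih =>
    simp only [List.length_cons] at hw
    rw [outerSum, outerSum, ih (i :: u) (by simp only [List.length_cons]; omega),
      innerSum_congr Y h w (by omega), h i u (by omega)]

-- Symmetric letters to the left of the first perturbed letter move across the inner product, in
-- reversed order. The word `u` records those already moved, which is what makes the induction
-- close.
omit [DecidableEq κ] in
lemma act_dotProduct_secondOrder {Y : σ → Matrix ι ι ℝ} (hY : ∀ i, (Y i).IsSymm)
    (K : σ → Matrix κ ι ℝ) (ξ : ι → ℝ) (Y' : σ → Matrix κ κ ℝ)
    (w u : List σ) :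
    act Y ξ u ⬝ᵥ secondOrder Y K (innerSum Y' fun j v => K j *ᵥ act Y ξ v) w =
      outerSum Y' (fun j v => K j *ᵥ act Y ξ v) (fun j v => K j *ᵥ act Y ξ v) u w := by
  induction w generalizing u with
  | nil => simp [secondOrder, outerSum]
  | cons i w ih =>
    rw [secondOrder, outerSum, dotProduct_add, ← dotProduct_mulVec_of_isSymm (hY i),
      ← act_cons, ih (i :: u), Matrix.dotProduct_mulVec (act Y ξ u), Matrix.vecMul_transpose,
      add_comm]

/-- The middle matrix of the Hessian is positive semidefinite where second differences are. -/
theorem middle_nonneg [Fintype σ] [DecidableEq σ] {p : Poly σ} {T : Set σ}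
    {Y : σ → Matrix ι ι ℝ} {Y' : σ → Matrix κ κ ℝ} (hY : ∀ i, (Y i).IsSymm)
    (h : SecondDiffNonneg p T fun i => Matrix.fromBlocks (Y i) 0 0 (Y' i))
    {D : ℕ} (hD : ∀ w, coeff p w ≠ 0 → w.length ≤ D) {ξ : ι → ℝ} {φ : List σ → ι → ℝ}
    (hφ : ∀ v w : List σ, v.length ≤ D → w.length ≤ D →
      φ w ⬝ᵥ act Y ξ v = if v = w then 1 else 0)
    {η : σ → List σ → κ → ℝ} (hη : ∀ i ∉ T, η i = 0) : 0 ≤ middle p Y' η η := by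
  -- By duality, `K i` sends `v(Y) ξ` to the prescribed vector `η i v`.
  let K : σ → Matrix κ ι ℝ := fun i => ∑ u : ShortWord σ D, Matrix.vecMulVec (η i u.1) (φ u.1)
  have hK (i : σ) (v : List σ) (hv : v.length ≤ D) : K i *ᵥ act Y ξ v = η i v := by
    simp only [K, Matrix.sum_mulVec, Matrix.vecMulVec_mulVec]
    rw [Finset.sum_eq_single ⟨v, hv⟩]
    · rw [hφ v v hv hv]
      simp
    · rintro ⟨u, hu⟩ - hne
      rw [hφ v u hv hu, if_neg fun h => hne (Subtype.ext h.symm)]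
      simp
    · simp
  obtain ⟨δ, hδ, hpos⟩ := h (fun i => Matrix.fromBlocks 0 (K i)ᵀ (K i) 0)
    (fun i => Matrix.IsSymm.fromBlocks (Matrix.isSymm_zero) (by simp) (Matrix.isSymm_zero))
    (fun i hi => by simp [K, hη i hi])
  choose R₁ R₂ hR₁ _ hR using act_fromBlocks_expansion Y Y' K ξ
  let S : List σ → ℝ → ℝ := fun w r => ξ ⬝ᵥ R₁ w r
  have hS (w : List σ) : Continuous (S w) := by
    have := hR₁ w
    simp only [S, dotProduct]
    fun_prop
  have hG (w : List σ) (hw : w.length ≤ D) :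
      ξ ⬝ᵥ secondOrder Y K (innerSum Y' fun j v => K j *ᵥ act Y ξ v) w =
        outerSum Y' η η [] w := by
    rw [← outerSum_congr Y' (fun j v hv => hK j v hv.le) w [] (by simpa using hw),
      ← act_dotProduct_secondOrder hY, act_nil]
  have hval (r : ℝ) :
      Sum.elim ξ 0 ⬝ᵥ (ev (fun i => Matrix.fromBlocks (Y i) 0 0 (Y' i) +
        r • Matrix.fromBlocks 0 (K i)ᵀ (K i) 0) p *ᵥ Sum.elim ξ 0) =
      ∑ w ∈ support p, coeff p w * (ξ ⬝ᵥ act Y ξ w) + r ^ 2 * middle p Y' η η +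
        r ^ 3 * ∑ w ∈ support p, coeff p w * S w r := by
    rw [ev_mulVec, dotProduct_sum, middle, Finset.mul_sum, Finset.mul_sum,
      ← Finset.sum_add_distrib, ← Finset.sum_add_distrib]
    refine Finset.sum_congr rfl fun w hw => ?_
    rw [dotProduct_smul, hR w r, sumElim_dotProduct_sumElim, dotProduct_add, dotProduct_add,
      dotProduct_smul, dotProduct_smul, hG w (hD w (mem_support.1 hw))]
    simp only [smul_eq_mul, zero_dotProduct, S]
    ring
  let F : ℝ → ℝ := fun r => ∑ w ∈ support p, coeff p w * S w r
  have hF : Continuous F := by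
    simp only [F]
    fun_prop
  -- In the second difference the terms of order zero cancel; dividing by `2r²` leaves the middle
  -- form and an error that tends to zero.
  have hineq (r : ℝ) (h0 : 0 < r) (hr : r < δ) :
      0 ≤ middle p Y' η η + r * (F r - F (-r)) / 2 := by
    have h1 := (hpos r h0 hr).dotProduct_mulVec_nonneg (Sum.elim ξ 0)
    have h2 := hval 0
    simp only [zero_smul, add_zero] at h2
    rw [star_trivial, Matrix.sub_mulVec, Matrix.add_mulVec, dotProduct_sub, dotProduct_add,
      hval r, hval (-r), Matrix.smul_mulVec, dotProduct_smul, h2, smul_eq_mul] at h1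
    have h3 : 0 ≤ (2 * r ^ 2) * (middle p Y' η η + r * (F r - F (-r)) / 2) := by
      simp only [F]
      linarith
    exact nonneg_of_mul_nonneg_right h3 (by positivity)
  have hlim : Filter.Tendsto (fun r => middle p Y' η η + r * (F r - F (-r)) / 2)
      (nhdsWithin 0 (Set.Ioi 0)) (nhds (middle p Y' η η)) := by
    have : Continuous fun r => middle p Y' η η + r * (F r - F (-r)) / 2 := by fun_prop
    simpa using (this.tendsto 0).mono_left nhdsWithin_le_nhds
  refine ge_of_tendsto hlim ?_
  filter_upwards [Ioo_mem_nhdsGT hδ] with r hr using hineq r hr.1 hr.2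

end Hessian

/-! ### Bilinearity and entries of the middle matrix -/

section MiddleForm

variable {σ : Type} {κ : Type} [Fintype κ]

lemma innerSum_add (Y : σ → Matrix κ κ ℝ) (η η' : σ → List σ → κ → ℝ) (w : List σ) :
    innerSum Y (η + η') w = innerSum Y η w + innerSum Y η' w := by
  induction w with
  | nil => simp [innerSum]
  | cons i w ih =>
    simp only [innerSum, ih, Matrix.mulVec_add, Pi.add_apply]
    abel

lemma innerSum_smul (Y : σ → Matrix κ κ ℝ) (s : ℝ) (η : σ → List σ → κ → ℝ) (w : List σ) :
    innerSum Y (s • η) w = s • innerSum Y η w := by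
  induction w with
  | nil => simp [innerSum]
  | cons i w ih => simp only [innerSum, ih, Matrix.mulVec_smul, Pi.smul_apply, smul_add]

lemma outerSum_add_left (Y : σ → Matrix κ κ ℝ) (ζ ζ' η : σ → List σ → κ → ℝ) (w u : List σ) :
    outerSum Y (ζ + ζ') η u w = outerSum Y ζ η u w + outerSum Y ζ' η u w := by
  induction w generalizing u with
  | nil => simp [outerSum]
  | cons i w ih =>
    simp only [outerSum, ih, Pi.add_apply, add_dotProduct]
    ring

lemma outerSum_add_right (Y : σ → Matrix κ κ ℝ) (ζ η η' : σ → List σ → κ → ℝ) (w u : List σ) :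
    outerSum Y ζ (η + η') u w = outerSum Y ζ η u w + outerSum Y ζ η' u w := by
  induction w generalizing u with
  | nil => simp [outerSum]
  | cons i w ih =>
    simp only [outerSum, ih, innerSum_add, dotProduct_add]
    ring

lemma outerSum_smul_left (Y : σ → Matrix κ κ ℝ) (s : ℝ) (ζ η : σ → List σ → κ → ℝ)
    (w u : List σ) : outerSum Y (s • ζ) η u w = s * outerSum Y ζ η u w := by
  induction w generalizing u with
  | nil => simp [outerSum]
  | cons i w ih => simp only [outerSum, ih, Pi.smul_apply, smul_dotProduct, smul_eq_mul, mul_add]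

lemma outerSum_smul_right (Y : σ → Matrix κ κ ℝ) (s : ℝ) (ζ η : σ → List σ → κ → ℝ)
    (w u : List σ) : outerSum Y ζ (s • η) u w = s * outerSum Y ζ η u w := by
  induction w generalizing u with
  | nil => simp [outerSum]
  | cons i w ih => simp only [outerSum, ih, innerSum_smul, dotProduct_smul, smul_eq_mul, mul_add]

/-- `middle p Y` as a bilinear map. -/
noncomputable def middleForm (p : Poly σ) (Y : σ → Matrix κ κ ℝ) :
    (σ → List σ → κ → ℝ) →ₗ[ℝ] (σ → List σ → κ → ℝ) →ₗ[ℝ] ℝ :=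
  LinearMap.mk₂ ℝ (middle p Y)
    (fun ζ ζ' η => by simp [middle, outerSum_add_left, mul_add, Finset.sum_add_distrib])
    (fun s ζ η => by
      simp only [middle, outerSum_smul_left, smul_eq_mul, Finset.mul_sum]
      exact Finset.sum_congr rfl fun _ _ => by ring)
    (fun ζ η η' => by simp [middle, outerSum_add_right, mul_add, Finset.sum_add_distrib])
    (fun s ζ η => by
      simp only [middle, outerSum_smul_right, smul_eq_mul, Finset.mul_sum]
      exact Finset.sum_congr rfl fun _ _ => by ring)

lemma middleForm_apply (p : Poly σ) (Y : σ → Matrix κ κ ℝ) (ζ η : σ → List σ → κ → ℝ) :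
    middleForm p Y ζ η = middle p Y ζ η := rfl

variable [DecidableEq σ]

/-- The family of vectors whose only nonzero member is `x`, at the place `(i, u)`. -/
def single (i : σ) (u : List σ) (x : κ → ℝ) : σ → List σ → κ → ℝ :=
  fun j v => if j = i ∧ v = u then x else 0

lemma innerSum_single_eq_zero (Y : σ → Matrix κ κ ℝ) (i : σ) (u : List σ) (x : κ → ℝ)
    (w : List σ) (h : ¬ (i :: u) <:+ w) : innerSum Y (single i u x) w = 0 := by
  induction w with
  | nil => rfl
  | cons j v ih =>
    rw [innerSum, ih fun h' => h (h'.trans (List.suffix_cons j v)), Matrix.mulVec_zero, zero_add,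
      single, if_neg]
    rintro ⟨rfl, rfl⟩
    exact h List.suffix_rfl

lemma innerSum_single [DecidableEq κ] (Y : σ → Matrix κ κ ℝ) (i : σ) (u : List σ) (x : κ → ℝ)
    (m : List σ) : innerSum Y (single i u x) (m ++ i :: u) = act Y x m := by
  induction m with
  | nil =>
    rw [List.nil_append, innerSum, innerSum_single_eq_zero Y i u x u]
    · simp [single]
    · intro h
      simpa using h.length_le
  | cons j m ih =>
    rw [List.cons_append, innerSum, ih, act_cons, single, if_neg, add_zero]
    rintro ⟨-, h⟩
    have := congrArg List.length h
    simp only [List.length_append, List.length_cons] at this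
    omega

lemma outerSum_single_eq_zero (Y : σ → Matrix κ κ ℝ) (j : σ) (v : List σ) (x : κ → ℝ)
    (η : σ → List σ → κ → ℝ) (w u : List σ)
    (h : ∀ l z, w = l ++ j :: z → l.reverse ++ u ≠ v) : outerSum Y (single j v x) η u w = 0 := by
  induction w generalizing u with
  | nil => rfl
  | cons i w ih =>
    rw [outerSum, ih (i :: u), single, if_neg, zero_dotProduct, add_zero]
    · rintro ⟨rfl, rfl⟩
      exact h [] w rfl rfl
    · rintro l z rfl h'
      exact h (i :: l) z rfl (by simpa using h')

lemma outerSum_single (Y : σ → Matrix κ κ ℝ) (j : σ) (x : κ → ℝ)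
    (η : σ → List σ → κ → ℝ) (l z u : List σ) :
    outerSum Y (single j (l.reverse ++ u) x) η u (l ++ j :: z) = x ⬝ᵥ innerSum Y η z := by
  induction l generalizing u with
  | nil =>
    rw [List.nil_append, outerSum, outerSum_single_eq_zero]
    · simp [single]
    · intro l' z' _ h
      have := congrArg List.length h
      simp only [List.length_append, List.length_cons, List.length_reverse, List.length_nil] at this
      omega
  | cons i l ih =>
    have := ih (i :: u)
    simp only [List.reverse_cons, List.append_assoc, List.cons_append, List.nil_append] at this ⊢
    rw [outerSum, this, single, if_neg, zero_dotProduct, zero_add]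
    rintro ⟨-, h⟩
    have := congrArg List.length h
    simp only [List.length_append, List.length_cons] at this
    omega

/-- The entries of the middle matrix. -/
theorem middle_single [DecidableEq κ] (p : Poly σ) (Y : σ → Matrix κ κ ℝ) (j i : σ)
    (v u : List σ) (x y : κ → ℝ) :
    middle p Y (single j v x) (single i u y) =
      ∑' m, coeff p (v.reverse ++ j :: (m ++ i :: u)) * (x ⬝ᵥ act Y y m) := by
  have h₁ : middle p Y (single j v x) (single i u y) =
      ∑' w, coeff p w * outerSum Y (single j v x) (single i u y) [] w := by
    rw [tsum_eq_sum (s := support p)]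
    · rfl
    · intro w hw
      rw [mem_support, not_not] at hw
      rw [hw, zero_mul]
  have hinj : Function.Injective fun m : List σ => v.reverse ++ j :: (m ++ i :: u) := by
    intro m m' h
    simpa using h
  rw [h₁, ← hinj.tsum_eq]
  · refine tsum_congr fun m => ?_
    have := outerSum_single Y j x (single i u y) v.reverse (m ++ i :: u) []
    simp only [List.reverse_reverse, List.append_nil] at this
    rw [this, innerSum_single]
  · intro w hw
    by_contra hne
    refine hw ?_
    simp only
    by_cases h : ∃ l z, w = l ++ j :: z ∧ l.reverse = v
    · obtain ⟨l, z, rfl, rfl⟩ := h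
      have := outerSum_single Y j x (single i u y) l z []
      rw [List.append_nil] at this
      rw [this, innerSum_single_eq_zero, dotProduct_zero, mul_zero]
      rintro ⟨m, rfl⟩
      exact hne ⟨m, by simp⟩
    · push Not at h
      rw [outerSum_single_eq_zero, mul_zero]
      intro l z hl hl'
      exact h l z hl (by simpa using hl')

end MiddleForm

/-! ### Local convexity and vanishing columns -/

section LocallyConvex

variable {σ : Type} [Fintype σ] [DecidableEq σ]

/-- Second differences of `p` in the letters of `T` are positive semidefinite at every symmetric
tuple, after rescaling the letters that are not in `U`. -/
def LocallyConvex (p : Poly σ) (T U : Set σ) : Prop :=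
  ∀ (ι : Type) [Fintype ι] [DecidableEq ι] (Y : σ → Matrix ι ι ℝ), (∀ i, (Y i).IsSymm) →
    ∃ t : σ → ℝ, (∀ i, t i ≠ 0) ∧ (∀ i ∈ U, t i = 1) ∧
      SecondDiffNonneg p T fun i => t i • Y i

/-- Rescaling the letters multiplies each vector `w(Y) ξ` by a nonzero number, so the dual family is
rescaled by the inverse. -/
lemma exists_dual_vectors_smul (D : ℕ) {t : σ → ℝ} (ht : ∀ i, t i ≠ 0) :
    ∃ φ : List σ → ShortWord σ D → ℝ, ∀ v w : List σ, v.length ≤ D → w.length ≤ D →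
      φ w ⬝ᵥ act (fun i => t i • fock σ D i) (vacuum σ D) v = if v = w then 1 else 0 := by
  obtain ⟨φ, hφ⟩ := exists_dual_vectors σ D
  refine ⟨fun w => (w.map t).prod⁻¹ • φ w, fun v w hv hw => ?_⟩
  rw [act_smul, dotProduct_smul, smul_dotProduct, hφ v w hv hw]
  split_ifs with h
  · subst h
    have : (v.map t).prod ≠ 0 := List.prod_ne_zero (by simpa using fun i _ => ht i)
    simp [this]
  · simp

lemma LocallyConvex.middle_nonneg {p : Poly σ} {T U : Set σ} (h : LocallyConvex p T U)
    {κ : Type} [Fintype κ] [DecidableEq κ] {Y : σ → Matrix κ κ ℝ} (hY : ∀ i, (Y i).IsSymm) :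
    ∃ t : σ → ℝ, (∀ i, t i ≠ 0) ∧ (∀ i ∈ U, t i = 1) ∧
      ∀ η : σ → List σ → κ → ℝ, (∀ i ∉ T, η i = 0) →
        0 ≤ middle p (fun i => t i • Y i) η η := by
  obtain ⟨D, hD⟩ := exists_degree_bound p
  obtain ⟨t, ht, htU, hconv⟩ := h (ShortWord σ D ⊕ κ)
    (fun i => Matrix.fromBlocks (fock σ D i) 0 0 (Y i))
    fun i => (fock_isSymm D i).fromBlocks (by simp) (hY i)
  obtain ⟨φ, hφ⟩ := exists_dual_vectors_smul D ht
  refine ⟨t, ht, htU, fun η hη => ?_⟩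
  simp only [Matrix.fromBlocks_smul, smul_zero] at hconv
  exact NCPoly.middle_nonneg (fun i => (fock_isSymm D i).smul (t i)) hconv hD hφ hη

/-- If a diagonal entry of the middle matrix vanishes, then so does its column. -/
theorem LocallyConvex.coeff_eq_zero {p : Poly σ} (hp : IsSelfAdjoint p) {T U : Set σ}
    (h : LocallyConvex p T U) {i : σ} (hi : i ∈ T) {u : List σ}
    (hu : ∀ m, coeff p (u.reverse ++ i :: (m ++ i :: u)) = 0) (l : List σ) {j : σ} (hj : j ∈ T)
    (m : List σ) : coeff p (l ++ j :: (m ++ i :: u)) = 0 := by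
  by_contra hne
  obtain ⟨D, hD⟩ := exists_degree_bound p
  have hlen (l m u : List σ) (i j : σ) (h : coeff p (l ++ j :: (m ++ i :: u)) ≠ 0) :
      m.length ≤ D := by
    have := hD _ h
    simp only [List.length_append, List.length_cons] at this
    omega
  obtain ⟨t, ht, -, hpos⟩ := h.middle_nonneg (fock_isSymm (σ := σ) D)
  obtain ⟨φ, hφ⟩ := exists_dual_vectors_smul D ht
  set Y : σ → Matrix (ShortWord σ D) (ShortWord σ D) ℝ := fun i => t i • fock σ D i with hY
  have hYs (i : σ) : (Y i).IsSymm := (fock_isSymm D i).smul (t i)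
  set c := coeff p (l ++ j :: (m ++ i :: u)) with hc
  -- The dual vector `φ m` isolates the word `m` inside the polynomial entry, so the off-diagonal
  -- value is the single coefficient `c`.
  set η := single i u (vacuum σ D)
  set ζ := single j l.reverse (φ m)
  have hηη : middle p Y η η = 0 := by
    rw [middle_single]
    simp [hu]
  have hζη : middle p Y ζ η = c := by
    rw [middle_single, tsum_eq_single m]
    · rw [hφ m m (hlen _ _ _ _ _ hne) (hlen _ _ _ _ _ hne), if_pos rfl, mul_one,
        List.reverse_reverse]
    · intro m' hm'
      by_cases h0 : coeff p (l ++ j :: (m' ++ i :: u)) = 0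
      · rw [List.reverse_reverse, h0, zero_mul]
      · rw [hφ m' m (hlen _ _ _ _ _ h0) (hlen _ _ _ _ _ hne), if_neg hm', mul_zero]
  have hηζ : middle p Y η ζ = c := by
    have hrev (m' : List σ) : coeff p (u.reverse ++ i :: (m' ++ j :: l.reverse)) =
        coeff p (l ++ j :: (m'.reverse ++ i :: u)) := by
      rw [← coeff_reverse hp]
      simp
    rw [middle_single, tsum_eq_single m.reverse]
    · rw [hrev, List.reverse_reverse, dotProduct_comm, act_dotProduct hYs, List.reverse_reverse,
        hφ m m (hlen _ _ _ _ _ hne) (hlen _ _ _ _ _ hne), if_pos rfl, mul_one]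
    · intro m' hm'
      rw [hrev, dotProduct_comm, act_dotProduct hYs]
      by_cases h0 : coeff p (l ++ j :: (m'.reverse ++ i :: u)) = 0
      · rw [h0, zero_mul]
      · rw [hφ _ m (hlen _ _ _ _ _ h0) (hlen _ _ _ _ _ hne), if_neg, mul_zero]
        rintro rfl
        exact hm' (by simp)
  have hq (s : ℝ) : 0 ≤ middle p Y ζ ζ + s * (2 * c) := by
    have h1 := hpos (ζ + s • η) fun k hk => by
      have h2 : k ≠ i := fun h => hk (h ▸ hi)
      have h3 : k ≠ j := fun h => hk (h ▸ hj)
      funext v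
      simp [ζ, η, single, h2, h3]
    rw [← middleForm_apply] at h1
    simp only [map_add, map_smul, LinearMap.add_apply, LinearMap.smul_apply, middleForm_apply,
      hηη, hζη, hηζ, smul_eq_mul] at h1
    linarith
  -- This value of `s` makes the supposedly nonnegative expression equal to `-1`.
  have h1 := hq (-(middle p Y ζ ζ + 1) / (2 * c))
  rw [div_mul_cancel₀ _ (by simpa using hne)] at h1
  linarith

end LocallyConvex

/-! ### Degree at most two in the convexity letters -/

section DegreeBound

variable {σ : Type} [Fintype σ] [DecidableEq σ]

/-- Downward induction on the length of the tail `u`. The diagonal words `uᵀ i m i u` of its column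
contain `k` in `uᵀ`; read with `k` as first marked letter, they have the longer tail `m i u`, which
contains `i ∈ T`. Tails of length at least `D` are excluded by the degree. -/
lemma LocallyConvex.coeff_eq_zero_of_mem {p : Poly σ} (hp : IsSelfAdjoint p) {T U : Set σ}
    (h : LocallyConvex p T U) {i j k : σ} (hi : i ∈ T) (hj : j ∈ T) (hk : k ∈ T)
    (l m : List σ) {u : List σ} (hku : k ∈ u) : coeff p (l ++ j :: (m ++ i :: u)) = 0 := by
  obtain ⟨D, hD⟩ := exists_degree_bound p
  obtain ⟨N, hN⟩ : ∃ N, N = D - u.length := ⟨_, rfl⟩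
  induction N using Nat.strong_induction_on generalizing l m u i j k with
  | _ N ih =>
    by_cases hu : D ≤ u.length
    · by_contra hne
      have := hD _ hne
      simp only [List.length_append, List.length_cons] at this
      omega
    · refine h.coeff_eq_zero hp hi (fun m => ?_) l hj m
      obtain ⟨u₁, u₂, rfl⟩ := List.append_of_mem hku
      simp only [List.length_append, List.length_cons] at hN hu
      have key := ih (D - (m ++ i :: (u₁ ++ k :: u₂)).length)
        (by simp only [List.length_append, List.length_cons]; omega) hi hk hi u₂.reverse
        u₁.reverse (u := m ++ i :: (u₁ ++ k :: u₂)) (by simp) rfl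
      simpa using key

omit [Fintype σ] [DecidableEq σ] in
lemma exists_eq_append_of_countP_pos {P : σ → Bool} {w : List σ} (h : 0 < w.countP P) :
    ∃ l j z, w = l ++ j :: z ∧ l.countP P = 0 ∧ P j ∧ z.countP P + 1 = w.countP P := by
  induction w with
  | nil => simp at h
  | cons i w ih =>
    by_cases hi : P i
    · exact ⟨[], i, w, rfl, rfl, hi, by simp [hi]⟩
    · obtain ⟨l, j, z, rfl, hl, hj, hz⟩ := ih (by simpa [hi] using h)
      exact ⟨i :: l, j, z, rfl, by simpa [hi] using hl, hj, by simpa [hi] using hz⟩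

/-- The degree of `p` in the letters of its convexity is at most two. -/
theorem LocallyConvex.countP_le_two {p : Poly σ} (hp : IsSelfAdjoint p) {P : σ → Bool}
    {U : Set σ} (h : LocallyConvex p {i | P i} U) {w : List σ} (hw : coeff p w ≠ 0) :
    w.countP P ≤ 2 := by
  by_contra! hlt
  obtain ⟨l, j, z, rfl, -, hj, hz⟩ := exists_eq_append_of_countP_pos (P := P) (w := w) (by omega)
  obtain ⟨m, i, u, rfl, -, hi, hu⟩ := exists_eq_append_of_countP_pos (P := P) (w := z) (by omega)
  obtain ⟨k, hk, hk'⟩ := List.countP_pos_iff.1 (show 0 < u.countP P by omega)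
  exact hw (h.coeff_eq_zero_of_mem hp hi hj hk' l m hk)

end DegreeBound

/-! ### The middle matrix at scalars -/

section Scalars

variable {σ : Type} [Fintype σ] [DecidableEq σ]

/-- Real numbers as matrices of size one. -/
def scalars (y : σ → ℝ) (i : σ) : Matrix Unit Unit ℝ := Matrix.diagonal fun _ => y i

omit [Fintype σ] [DecidableEq σ] in
lemma act_scalars (y : σ → ℝ) (x : Unit → ℝ) (m : List σ) :
    act (scalars y) x m = (m.map y).prod • x := by
  induction m with
  | nil => simp
  | cons i m ih =>
    funext u
    simp [ih, scalars, Matrix.mulVec_diagonal, mul_assoc]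

omit [Fintype σ] in
lemma middle_scalars (p : Poly σ) (y : σ → ℝ) (j i : σ) (v u : List σ) :
    middle p (scalars y) (single j v 1) (single i u 1) =
      ∑' m, coeff p (v.reverse ++ j :: (m ++ i :: u)) * (m.map y).prod := by
  rw [middle_single]
  simp [act_scalars]

/-- Scalars supported on `U` are untouched by the rescaling allowed in `LocallyConvex`: off `U` they
are zero, and on `U` the factor is one. -/
lemma LocallyConvex.middle_scalars_nonneg {p : Poly σ} {T U : Set σ} (h : LocallyConvex p T U)
    {y : σ → ℝ} (hy : ∀ i ∉ U, y i = 0) {τ : Type} [Fintype τ] (f : τ → σ)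
    (hf : ∀ a, f a ∈ T) (v : τ → List σ) (θ : τ → ℝ) :
    0 ≤ ∑ a, ∑ b, θ a * θ b *
      ∑' m, coeff p ((v a).reverse ++ f a :: (m ++ f b :: v b)) * (m.map y).prod := by
  obtain ⟨t, -, htU, hpos⟩ := h.middle_nonneg (Y := scalars y) fun i => by simp [scalars]
  have hY : (fun i => t i • scalars y i) = scalars y := by
    funext i
    by_cases hi : i ∈ U
    · rw [htU i hi, one_smul]
    · simp [scalars, hy i hi]
  rw [hY] at hpos
  have := hpos (∑ a, θ a • single (f a) (v a) 1) fun i hi => by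
    have (a : τ) : i ≠ f a := fun h => hi (h ▸ hf a)
    funext w
    simp [single, this]
  rw [← middleForm_apply] at this
  simp only [map_sum, map_smul, LinearMap.sum_apply, LinearMap.smul_apply, middleForm_apply,
    middle_scalars, smul_eq_mul] at this
  refine this.trans_eq ?_
  simp only [Finset.mul_sum]
  rw [Finset.sum_comm]
  exact Finset.sum_congr rfl fun a _ => Finset.sum_congr rfl fun b _ => by ring

/-- The constant term of the middle matrix is positive semidefinite. -/
lemma LocallyConvex.sum_coeff_nonneg {p : Poly σ} {T U : Set σ} (h : LocallyConvex p T U)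
    {τ : Type} [Fintype τ] (f : τ → σ) (hf : ∀ a, f a ∈ T) (v : τ → List σ) (θ : τ → ℝ) :
    0 ≤ ∑ a, ∑ b, θ a * θ b * coeff p ((v a).reverse ++ f a :: f b :: v b) := by
  refine (h.middle_scalars_nonneg (y := 0) (fun _ _ => rfl) f hf v θ).trans_eq ?_
  refine Finset.sum_congr rfl fun a _ => Finset.sum_congr rfl fun b _ => ?_
  rw [tsum_eq_single []]
  · simp
  · rintro (_ | ⟨i, m⟩) h
    · exact absurd rfl h
    · simp

lemma nonneg_of_quadratic_nonneg {a b c : ℝ} (h : ∀ t : ℝ, 0 ≤ a + b * t + c * t ^ 2) :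
    0 ≤ c := by
  by_contra! hc
  -- Adding the values at opposite points removes the linear term; the point is large enough for the
  -- negative quadratic term to outweigh `a`.
  have h1 := h ((|a| + 1) / (-c) + 1)
  have h2 := h (-((|a| + 1) / (-c) + 1))
  set s := (|a| + 1) / (-c) with hs
  have h3 : -c * s = |a| + 1 := by
    rw [hs, mul_div_cancel₀ _ (by linarith)]
  have h4 : 0 ≤ s := by
    have : 0 < -c := by linarith
    positivity
  nlinarith [le_abs_self a, mul_nonneg h4 h4, mul_nonneg h4 (neg_nonneg.2 hc.le)]

lemma eq_zero_of_linear_nonneg {a b : ℝ} (h : ∀ t : ℝ, 0 ≤ a + b * t) : b = 0 := by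
  by_contra hb
  have := h (-(a + 1) / b)
  rw [mul_div_cancel₀ _ hb] at this
  linarith

end Scalars

/-! ### The words that can occur in `p` -/

section Structure

variable {g : ℕ} {p : PolyAX g}

/-- With every letter except `x` set to zero, only powers of `x` survive in the middle, and the
degree bound stops them at the square. -/
lemma tsum_coeff_mul_single {q : PolyAX g} (x : Fin g) (t : ℝ)
    (hq : ∀ w, coeff q w ≠ 0 → w.countP Sum.isRight ≤ 2) (j i : Fin g ⊕ Fin g) :
    ∑' m, coeff q (j :: (m ++ [i])) * (m.map (Pi.single (Sum.inr x) t)).prod =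
      coeff q [j, i] + coeff q [j, Sum.inr x, i] * t +
        coeff q [j, Sum.inr x, Sum.inr x, i] * t ^ 2 := by
  rw [tsum_eq_sum (s := {[], [Sum.inr x], [Sum.inr x, Sum.inr x]})]
  · rw [Finset.sum_insert (by simp), Finset.sum_insert (by simp), Finset.sum_singleton]
    simp
    ring
  · intro m hm
    by_cases hall : ∀ k ∈ m, k = Sum.inr x
    · obtain ⟨n, rfl⟩ : ∃ n, m = List.replicate n (Sum.inr x) :=
        ⟨m.length, List.eq_replicate_of_mem hall⟩
      by_cases hn : n ≤ 2
      · exfalso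
        interval_cases n <;> simp [List.replicate] at hm
      · by_contra hne
        have := hq _ (left_ne_zero_of_mul hne)
        simp only [List.countP_cons, List.countP_append, List.countP_replicate,
          Sum.isRight_inr, if_true] at this
        omega
    · push Not at hall
      obtain ⟨k, hk, hkx⟩ := hall
      rw [List.prod_eq_zero, mul_zero]
      exact List.mem_map.2 ⟨k, hk, by simp [hkx]⟩

variable (hp : IsSelfAdjoint p)
  (hx : LocallyConvex p {i | Sum.isRight i} {i | Sum.isRight i})
  (ha : LocallyConvex (-p) {i | Sum.isLeft i} {i | Sum.isRight i})

include hp hx in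
lemma countP_isRight_le {w : List (Fin g ⊕ Fin g)} (hw : coeff p w ≠ 0) :
    w.countP Sum.isRight ≤ 2 := hx.countP_le_two hp hw

include hp ha in
lemma countP_isLeft_le {w : List (Fin g ⊕ Fin g)} (hw : coeff p w ≠ 0) :
    w.countP Sum.isLeft ≤ 2 :=
  ha.countP_le_two hp.neg (by rwa [coeff_neg, neg_ne_zero])

include hp hx ha in
lemma quadratic_nonneg {τ : Type} [Fintype τ] (k : τ → Fin g) (x : Fin g) (t : ℝ) :
    0 ≤ ∑ a, ∑ b, -(coeff p [Sum.inl (k a), Sum.inl (k b)] +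
      coeff p [Sum.inl (k a), Sum.inr x, Sum.inl (k b)] * t +
        coeff p [Sum.inl (k a), Sum.inr x, Sum.inr x, Sum.inl (k b)] * t ^ 2) := by
  have := ha.middle_scalars_nonneg (y := Pi.single (Sum.inr x) t)
    (fun i hi => by
      have : i ≠ Sum.inr x := by
        rintro rfl
        exact hi rfl
      simp [this])
    (fun a => Sum.inl (k a)) (fun a => rfl) (fun _ => []) (fun _ => 1)
  refine this.trans_eq (Finset.sum_congr rfl fun a _ => Finset.sum_congr rfl fun b _ => ?_)
  simp only [List.reverse_nil, List.nil_append]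
  rw [tsum_coeff_mul_single x t fun w hw => countP_isRight_le hp hx (by
    rwa [coeff_neg, neg_ne_zero] at hw)]
  simp only [coeff_neg]
  ring

-- Two opposite signs: the entry of the `a`-middle matrix of `-p` at scalar `x = t` is quadratic in
-- `t` and nonnegative, while the constant term of the `x`-middle matrix of `p` is nonnegative.
include hp hx ha in
lemma coeff_axxa (k x : Fin g) :
    coeff p [Sum.inl k, Sum.inr x, Sum.inr x, Sum.inl k] = 0 := by
  refine le_antisymm ?_ ?_
  · have := nonneg_of_quadratic_nonneg (a := -coeff p [Sum.inl k, Sum.inl k])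
      (b := -coeff p [Sum.inl k, Sum.inr x, Sum.inl k])
      (c := -coeff p [Sum.inl k, Sum.inr x, Sum.inr x, Sum.inl k]) fun t => by
        have := quadratic_nonneg hp hx ha (fun _ : Unit => k) x t
        simp only [Finset.univ_unique, Finset.sum_const, Finset.card_singleton, one_smul] at this
        linarith
    linarith
  · simpa using hx.sum_coeff_nonneg (fun _ : Unit => Sum.inr x) (fun _ => rfl)
      (fun _ => [Sum.inl k]) 1

include hp hx ha in
/-- No word of degree two in `x` ends in a letter `a_k`. -/
lemma coeff_xx_a (l m : List (Fin g ⊕ Fin g)) (j i : Fin g) {u : List (Fin g ⊕ Fin g)}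
    (hu : u ≠ []) : coeff p (l ++ Sum.inr j :: (m ++ Sum.inr i :: u)) = 0 := by
  refine hx.coeff_eq_zero hp rfl (fun m => ?_) l rfl m
  -- The degree bounds force a nonzero diagonal word to have `u` a single letter `a_k` and `m`
  -- empty, hence to be `a_k x_i x_i a_k`.
  by_contra hne
  have h1 := countP_isRight_le hp hx hne
  have h2 := countP_isLeft_le hp ha hne
  simp only [List.countP_append, List.countP_reverse, List.countP_cons, Sum.isRight_inr,
    Sum.isLeft_inr, if_true, Bool.false_eq_true, if_false] at h1 h2
  have h3 (w : List (Fin g ⊕ Fin g)) : w.length = w.countP Sum.isRight + w.countP Sum.isLeft := by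
    rw [List.length_eq_countP_add_countP Sum.isRight]
    congr 2
    funext k
    simp
  have hul := h3 u
  have hml := h3 m
  have hu' := List.length_pos_iff.2 hu
  obtain ⟨k, rfl⟩ := List.length_eq_one_iff.1 (show u.length = 1 by omega)
  obtain rfl := List.length_eq_zero_iff.1 (show m.length = 0 by omega)
  rcases k with k | k
  · exact hne (coeff_axxa hp hx ha k i)
  · simp at h1

include hp hx ha in
lemma coeff_a_xx (m u : List (Fin g ⊕ Fin g)) (j i : Fin g) {l : List (Fin g ⊕ Fin g)}
    (hl : l ≠ []) : coeff p (l ++ Sum.inr j :: (m ++ Sum.inr i :: u)) = 0 := by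
  rw [← coeff_reverse hp]
  have := coeff_xx_a hp hx ha u.reverse m.reverse i j (u := l.reverse) (by simpa using hl)
  simpa using this

-- With the squares in `t` gone, the nonnegative form is affine in `t`, so its slope vanishes. This
-- settles `k = l`; the test on the sum of the two letters gives the rest by polarization and
-- symmetry of `p`.
include hp hx ha in
lemma coeff_axa (k x l : Fin g) : coeff p [Sum.inl k, Sum.inr x, Sum.inl l] = 0 := by
  have h2 (k l : Fin g) : coeff p [Sum.inl k, Sum.inr x, Sum.inr x, Sum.inl l] = 0 :=
    coeff_xx_a hp hx ha [Sum.inl k] [] x x (u := [Sum.inl l]) (by simp)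
  have hd (k : Fin g) : coeff p [Sum.inl k, Sum.inr x, Sum.inl k] = 0 := by
    have := eq_zero_of_linear_nonneg (a := -coeff p [Sum.inl k, Sum.inl k])
      (b := -coeff p [Sum.inl k, Sum.inr x, Sum.inl k]) fun t => by
        have := quadratic_nonneg hp hx ha (fun _ : Unit => k) x t
        simp only [Finset.univ_unique, Finset.sum_const, Finset.card_singleton, one_smul,
          h2] at this
        linarith
    linarith
  have hr : coeff p [Sum.inl l, Sum.inr x, Sum.inl k] =
      coeff p [Sum.inl k, Sum.inr x, Sum.inl l] := by
    rw [← coeff_reverse hp]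
    rfl
  have := eq_zero_of_linear_nonneg
    (a := -coeff p [Sum.inl k, Sum.inl k] - coeff p [Sum.inl k, Sum.inl l]
      - coeff p [Sum.inl l, Sum.inl k] - coeff p [Sum.inl l, Sum.inl l])
    (b := -2 * coeff p [Sum.inl k, Sum.inr x, Sum.inl l]) fun t => by
      have := quadratic_nonneg hp hx ha ![k, l] x t
      simp [Fin.sum_univ_two, h2, hd, hr] at this
      linarith
  linarith

/-- The letter of `W` with the given index, as a word. -/
def letterW (α : Fin (g + 1)) : List (Fin g ⊕ Fin g) :=
  Fin.cases [] (fun i => [Sum.inr i]) α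

lemma exists_eq_map_inl {l : List (Fin g ⊕ Fin g)} (h : l.countP Sum.isRight = 0) :
    ∃ m : List (Fin g), l = m.map Sum.inl ∧ l.countP Sum.isLeft = m.length := by
  induction l with
  | nil => exact ⟨[], rfl, rfl⟩
  | cons i l ih =>
    rcases i with i | i
    · obtain ⟨m, rfl, hm⟩ := ih (by simpa using h)
      exact ⟨i :: m, rfl, by rw [List.countP_cons, hm]; rfl⟩
    · simp at h

include hp hx ha in
/-- All words of `p` have the form `W_α m(a) W_β` with `m` of degree at most two. -/
theorem exists_eq_letterW_append {w : List (Fin g ⊕ Fin g)} (hw : coeff p w ≠ 0) :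
    ∃ α β : Fin (g + 1), ∃ m : List (Fin g), m.length ≤ 2 ∧
      w = letterW α ++ (m.map Sum.inl ++ letterW β) := by
  have h1 := countP_isRight_le hp hx hw
  have h2 := countP_isLeft_le hp ha hw
  rcases Nat.eq_zero_or_pos (w.countP Sum.isRight) with h0 | h0
  · obtain ⟨m, rfl, hm⟩ := exists_eq_map_inl h0
    exact ⟨0, 0, m, by omega, by simp [letterW]⟩
  obtain ⟨l, j | j, z, rfl, hl, hj, hz⟩ := exists_eq_append_of_countP_pos h0
  · simp at hj
  obtain ⟨l, rfl, hl'⟩ := exists_eq_map_inl hl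
  rcases Nat.eq_zero_or_pos (z.countP Sum.isRight) with hz0 | hz0
  · obtain ⟨z, rfl, hz'⟩ := exists_eq_map_inl hz0
    rw [List.countP_append, List.countP_cons, hl', hz'] at h2
    simp only [Sum.isLeft_inr, Bool.false_eq_true, if_false] at h2
    rcases l with _ | ⟨a, l⟩
    · exact ⟨j.succ, 0, z, by simpa using h2, by simp [letterW]⟩
    rcases z with _ | ⟨b, z⟩
    · exact ⟨0, j.succ, a :: l, by simpa using h2, by simp [letterW]⟩
    -- With letters `a` on both sides of the only `x`, the degree bound leaves just `a x a`.
    simp only [List.length_cons] at h2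
    obtain rfl := List.length_eq_zero_iff.1 (show l.length = 0 by omega)
    obtain rfl := List.length_eq_zero_iff.1 (show z.length = 0 by omega)
    exact absurd (coeff_axa hp hx ha a j b) hw
  · obtain ⟨m, i | i, u, rfl, hm, hi, hu⟩ := exists_eq_append_of_countP_pos hz0
    · simp at hi
    obtain ⟨m, rfl, hm'⟩ := exists_eq_map_inl hm
    obtain rfl : u = [] := by
      by_contra hne
      exact hw (coeff_xx_a hp hx ha _ _ _ _ hne)
    have hl0 : l.map Sum.inl = ([] : List (Fin g ⊕ Fin g)) := by
      by_contra hne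
      exact hw (coeff_a_xx hp hx ha _ _ _ _ hne)
    rw [hl0] at h2 ⊢
    refine ⟨j.succ, i.succ, m, ?_, by simp [letterW]⟩
    simp only [List.nil_append, List.countP_append, List.countP_cons, hm'] at h2
    omega

end Structure

/-! ### Block evaluation and quadratic forms -/

section BlockEvaluation

variable {g k n : ℕ}

lemma evalMat_apply (M : Matrix (Fin k) (Fin k) (Poly (Fin g))) (A : Tuple (Fin g) n)
    (i j : Fin k) (a b : Fin n) : evalMat M A (i, a) (j, b) = eval A (M i j) a b := rfl

lemma evalMat_sub (M N : Matrix (Fin k) (Fin k) (Poly (Fin g))) (A : Tuple (Fin g) n) :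
    evalMat (M - N) A = evalMat M A - evalMat N A := by
  ext ⟨i, a⟩ ⟨j, b⟩
  simp [evalMat_apply]

lemma evalMat_isHermitian {M : Matrix (Fin k) (Fin k) (Poly (Fin g))} (hM : M.IsHermitian)
    {A : Tuple (Fin g) n} (hA : A ∈ symTuples g n) : (evalMat M A).IsHermitian := by
  ext ⟨i, a⟩ ⟨j, b⟩
  rw [Matrix.conjTranspose_apply, star_trivial, evalMat_apply, evalMat_apply, ← hM.apply i j,
    eval_eq_ev, ← transpose_ev hA, Matrix.transpose_apply]

/-- The vector `W(X) v`. -/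
def stack (X : Tuple (Fin g) n) (v : Fin n → ℝ) : Fin (g + 1) × Fin n → ℝ :=
  fun i => Fin.cases v (fun j => X j *ᵥ v) i.1 i.2

lemma evalAX_W_mulVec (A X : Tuple (Fin g) n) (v : Fin n → ℝ) (i : Fin (g + 1)) :
    evalAX (W g i) A X *ᵥ v = fun a => stack X v (i, a) := by
  refine Fin.cases ?_ (fun j => ?_) i
  · simp [evalAX, W, stack]
  · simp [evalAX, W, stack, eval]

lemma star_W (i : Fin (g + 1)) : star (W g i) = W g i := by
  refine Fin.cases ?_ (fun j => ?_) i
  · simp [W]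
  · simp [W]

lemma evalAX_ofA (q : Poly (Fin g)) (A X : Tuple (Fin g) n) :
    evalAX (ofA g q) A X = eval A q := by
  have : (eval (Sum.elim A X)).comp (ofA g) = eval A := by
    ext i : 2
    simp [eval, ofA]
  rw [← this]
  rfl

lemma isSymm_sumElim {A X : Tuple (Fin g) n} (hA : A ∈ symTuples g n) (hX : X ∈ symTuples g n) :
    ∀ i, (Sum.elim A X i).IsSymm
  | Sum.inl i => hA i
  | Sum.inr i => hX i

/-- Moves the symmetric factors `W_i(X)` onto the test vector; both directions of the theorem
compare `p` with its matrix through this identity. -/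
lemma dotProduct_sandwich (M : Matrix (Fin (g + 1)) (Fin (g + 1)) (Poly (Fin g)))
    {A X : Tuple (Fin g) n} (hA : A ∈ symTuples g n) (hX : X ∈ symTuples g n) (v : Fin n → ℝ) :
    v ⬝ᵥ (evalAX (sandwich M) A X *ᵥ v) = stack X v ⬝ᵥ (evalMat M A *ᵥ stack X v) := by
  have hterm (i j : Fin (g + 1)) :
      v ⬝ᵥ (evalAX (star (W g i) * ofA g (M i j) * W g j) A X *ᵥ v) =
        ∑ a, stack X v (i, a) * ∑ b, eval A (M i j) a b * stack X v (j, b) := by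
    have hsymm : (evalAX (W g i) A X).IsSymm := by
      have := transpose_ev (isSymm_sumElim hA hX) (W g i)
      rwa [star_W] at this
    have : evalAX (star (W g i) * ofA g (M i j) * W g j) A X =
        evalAX (W g i) A X * eval A (M i j) * evalAX (W g j) A X := by
      rw [star_W, ← evalAX_ofA (M i j) A X]
      simp [evalAX]
    rw [this, ← Matrix.mulVec_mulVec, ← Matrix.mulVec_mulVec, evalAX_W_mulVec A X v j,
      ← dotProduct_mulVec_of_isSymm hsymm, evalAX_W_mulVec A X v i]
    rfl
  have hsum : evalAX (sandwich M) A X =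
      ∑ i, ∑ j, evalAX (star (W g i) * ofA g (M i j) * W g j) A X := by
    simp [sandwich, evalAX, map_sum]
  rw [hsum]
  simp only [Matrix.sum_mulVec, dotProduct_sum, hterm]
  simp only [dotProduct, Matrix.mulVec, Fintype.sum_prod_type, evalMat_apply, Finset.mul_sum]
  exact Finset.sum_congr rfl fun i _ => Finset.sum_comm

lemma isHermitian_evalAX {p : PolyAX g} (hp : IsSelfAdjoint p) {A X : Tuple (Fin g) n}
    (hA : A ∈ symTuples g n) (hX : X ∈ symTuples g n) : (evalAX p A X).IsHermitian :=
  isHermitian_ev (isSymm_sumElim hA hX) hp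

lemma isHermitian_real_smul {ι : Type} {M : Matrix ι ι ℝ} (hM : M.IsHermitian) (t : ℝ) :
    (t • M).IsHermitian := by
  rw [Matrix.IsHermitian, Matrix.conjTranspose_smul, hM.eq, star_trivial]

lemma symTuples_combo {A B : Tuple (Fin g) n} (hA : A ∈ symTuples g n) (hB : B ∈ symTuples g n)
    (s t : ℝ) : s • A + t • B ∈ symTuples g n :=
  fun j => ((hA j).smul s).add ((hB j).smul t)

lemma quadratic_combo {ι : Type} [Fintype ι] (N : Matrix ι ι ℝ) (v w : ι → ℝ) (t : ℝ) :
    t * (v ⬝ᵥ (N *ᵥ v)) + (1 - t) * (w ⬝ᵥ (N *ᵥ w)) -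
      (t • v + (1 - t) • w) ⬝ᵥ (N *ᵥ (t • v + (1 - t) • w)) =
    t * (1 - t) * ((v - w) ⬝ᵥ (N *ᵥ (v - w))) := by
  simp only [Matrix.mulVec_add, Matrix.mulVec_sub, Matrix.mulVec_smul, dotProduct_add,
    dotProduct_sub, add_dotProduct, sub_dotProduct, smul_dotProduct, dotProduct_smul, smul_eq_mul]
  ring

lemma stack_combo (X Y : Tuple (Fin g) n) (t : ℝ) (v : Fin n → ℝ) :
    stack (t • X + (1 - t) • Y) v = t • stack X v + (1 - t) • stack Y v := by
  funext ⟨i, a⟩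
  refine Fin.cases ?_ (fun j => ?_) i
  · simp only [stack, Fin.cases_zero, Pi.add_apply, Pi.smul_apply, smul_eq_mul]
    ring
  · simp [stack, Matrix.add_mulVec, Matrix.smul_mulVec]

lemma eval_combo_of_degreeLE_one {q : Poly (Fin g)} (hq : DegreeLE 1 q) (A B : Tuple (Fin g) n)
    (t : ℝ) : eval (t • A + (1 - t) • B) q = t • eval A q + (1 - t) • eval B q := by
  induction hq using Submodule.span_induction with
  | mem q hq =>
    obtain ⟨w, hw, rfl⟩ := hq
    rcases w with _ | ⟨i, _ | ⟨j, w⟩⟩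
    · rw [word_nil, map_one, map_one, map_one, ← add_smul]
      simp
    · simp [eval]
    · simp at hw
  | zero => simp
  | add q r _ _ hq hr =>
    simp only [map_add, hq, hr]
    module
  | smul c q _ hq =>
    simp only [map_smul, hq]
    module

lemma eval_combo_of_homogeneous_two {q : Poly (Fin g)} (hq : Homogeneous 2 q)
    (A B : Tuple (Fin g) n) (t : ℝ) :
    t • eval A q + (1 - t) • eval B q - eval (t • A + (1 - t) • B) q =
      (t * (1 - t)) • eval (A - B) q := by
  induction hq using Submodule.span_induction with
  | mem q hq =>
    obtain ⟨w, hw, rfl⟩ := hq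
    obtain ⟨i, j, rfl⟩ := List.length_eq_two.1 hw
    simp only [word_cons, word_nil, mul_one, map_mul, eval_eq_ev, ev_ι, Pi.add_apply,
      Pi.smul_apply, Pi.sub_apply, mul_add, add_mul, sub_mul, mul_sub, smul_mul_assoc,
      mul_smul_comm]
    module
  | zero => simp
  | add q r _ _ hq hr =>
    simp only [map_add, smul_add, ← hq, ← hr]
    abel
  | smul c q _ hq =>
    simp only [map_smul]
    rw [smul_comm (t * (1 - t)) c, ← hq]
    module

lemma sub_mem_symTuples {A B : Tuple (Fin g) n} (hA : A ∈ symTuples g n)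
    (hB : B ∈ symTuples g n) : A - B ∈ symTuples g n := fun j => (hA j).sub (hB j)

end BlockEvaluation

/-! ### From a representation to the three conditions -/

section Converse

variable {g : ℕ} {p : PolyAX g} {R Q : Matrix (Fin (g + 1)) (Fin (g + 1)) (Poly (Fin g))}

theorem IsRepresentation.nonnegOnBall (hp : IsSelfAdjoint p) (h : IsRepresentation p R Q) :
    NonnegOnBall p := by
  intro n A hA X hX
  refine .of_dotProduct_mulVec_nonneg (isHermitian_evalAX hp hA.1 hX) fun v => ?_
  rw [star_trivial, h.eq_sandwich, dotProduct_sandwich _ hA.1 hX, evalMat_sub]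
  exact (h.nonneg_sub n A hA).dotProduct_mulVec_nonneg _

theorem IsRepresentation.convexInXOnBall (hp : IsSelfAdjoint p) (h : IsRepresentation p R Q) :
    ConvexInXOnBall p := by
  intro n A hA X hX Y hY t ht0 ht1
  have hZ := symTuples_combo hX hY t (1 - t)
  refine .of_dotProduct_mulVec_nonneg ?_ fun v => ?_
  · exact ((isHermitian_real_smul (isHermitian_evalAX hp hA.1 hX) t).add
      (isHermitian_real_smul (isHermitian_evalAX hp hA.1 hY) _)).sub
      (isHermitian_evalAX hp hA.1 hZ)
  · rw [star_trivial, Matrix.sub_mulVec, Matrix.add_mulVec, Matrix.smul_mulVec,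
      Matrix.smul_mulVec, dotProduct_sub, dotProduct_add, dotProduct_smul, dotProduct_smul,
      h.eq_sandwich, dotProduct_sandwich _ hA.1 hX, dotProduct_sandwich _ hA.1 hY,
      dotProduct_sandwich _ hA.1 hZ, stack_combo, smul_eq_mul, smul_eq_mul, quadratic_combo,
      evalMat_sub]
    exact mul_nonneg (mul_nonneg ht0.le (by linarith))
      ((h.nonneg_sub n A hA).dotProduct_mulVec_nonneg _)

theorem IsRepresentation.concaveInA (hp : IsSelfAdjoint p) (h : IsRepresentation p R Q) :
    ConcaveInA p := by
  intro n A hA B hB X hX t ht0 ht1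
  have hC := symTuples_combo hA hB t (1 - t)
  refine .of_dotProduct_mulVec_nonneg ?_ fun v => ?_
  · exact (isHermitian_evalAX hp hC hX).sub
      ((isHermitian_real_smul (isHermitian_evalAX hp hA hX) t).add
      (isHermitian_real_smul (isHermitian_evalAX hp hB hX) _))
  -- The affine part `R` has no defect, and that of `-Q` is a multiple of `Q(A - B)`. As `A - B` is
  -- arbitrary, positivity of `Q` is needed at all symmetric tuples.
  · have hM : evalMat (R - Q) (t • A + (1 - t) • B) = t • evalMat (R - Q) A +
        (1 - t) • evalMat (R - Q) B + (t * (1 - t)) • evalMat Q (A - B) := by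
      ext ⟨i, a⟩ ⟨j, b⟩
      have h1 := eval_combo_of_degreeLE_one (h.degree_R i j) A B t
      have h2 := eval_combo_of_homogeneous_two (h.homogeneous_Q i j) A B t
      simp only [Matrix.add_apply, Matrix.smul_apply, evalMat_apply]
      have : eval (t • A + (1 - t) • B) ((R - Q) i j) = t • eval A ((R - Q) i j) +
          (1 - t) • eval B ((R - Q) i j) + (t * (1 - t)) • eval (A - B) (Q i j) := by
        rw [← h2, Matrix.sub_apply, map_sub, map_sub, map_sub, h1]
        module
      rw [this]
      rfl
    rw [star_trivial, Matrix.sub_mulVec, Matrix.add_mulVec, Matrix.smul_mulVec,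
      Matrix.smul_mulVec, dotProduct_sub, dotProduct_add, dotProduct_smul, dotProduct_smul,
      h.eq_sandwich, dotProduct_sandwich _ hA hX, dotProduct_sandwich _ hB hX,
      dotProduct_sandwich _ hC hX, hM]
    simp only [Matrix.add_mulVec, Matrix.smul_mulVec, dotProduct_add, dotProduct_smul,
      add_sub_cancel_left, smul_eq_mul]
    exact mul_nonneg (mul_nonneg ht0.le (by linarith))
      ((h.nonneg_Q n _ (sub_mem_symTuples hA hB)).dotProduct_mulVec_nonneg _)

end Converse

/-! ### From global convexity and concavity to `LocallyConvex` -/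

section Hypotheses

variable {g : ℕ} {p : PolyAX g}

lemma dotProduct_mulVec_le {ι : Type} [Fintype ι] (P : Matrix ι ι ℝ) (v : ι → ℝ) :
    v ⬝ᵥ (P *ᵥ v) ≤ (∑ i, ∑ j, |P i j|) * (v ⬝ᵥ v) := by
  have hle (i : ι) : v i * v i ≤ v ⬝ᵥ v :=
    Finset.single_le_sum (f := fun k => v k * v k) (fun k _ => mul_self_nonneg _)
      (Finset.mem_univ i)
  generalize v ⬝ᵥ v = c at hle ⊢
  simp only [dotProduct, Matrix.mulVec, Finset.mul_sum, Finset.sum_mul]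
  refine Finset.sum_le_sum fun i _ => Finset.sum_le_sum fun j _ => ?_
  have h1 : v i * (P i j * v j) ≤ |P i j| * |v i * v j| := by
    rw [← abs_mul]
    exact (le_abs_self _).trans_eq (by ring_nf)
  refine h1.trans (mul_le_mul_of_nonneg_left ?_ (abs_nonneg _))
  rw [abs_le]
  constructor <;> nlinarith [hle i, hle j, sq_nonneg (v i + v j), sq_nonneg (v i - v j)]

lemma exists_smul_mem_unitBall {n : ℕ} {A : Tuple (Fin g) n} (hA : A ∈ symTuples g n) :
    ∃ s : ℝ, s ≠ 0 ∧ s • A ∈ unitBall g n := by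
  set P := ∑ j, A j * A j with hP
  have hPH : P.IsHermitian := by
    rw [Matrix.IsHermitian, Matrix.conjTranspose_eq_transpose_of_trivial, hP,
      Matrix.transpose_sum]
    exact Finset.sum_congr rfl fun j _ => by rw [Matrix.transpose_mul, (hA j).eq]
  set C := ∑ i, ∑ j, |P i j| with hC
  have hC0 : 0 ≤ C := Finset.sum_nonneg fun i _ => Finset.sum_nonneg fun j _ => abs_nonneg _
  -- The entry sum `C` bounds the quadratic form of `∑ A_j²`, and `C < (C + 1)²`.
  refine ⟨(C + 1)⁻¹, by positivity, fun j => (hA j).smul (C + 1)⁻¹, ?_⟩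
  have hsum : ∑ j, ((C + 1)⁻¹ • A) j * ((C + 1)⁻¹ • A) j = ((C + 1)⁻¹ ^ 2) • P := by
    rw [hP, Finset.smul_sum]
    refine Finset.sum_congr rfl fun j _ => ?_
    rw [Pi.smul_apply, smul_mul_smul_comm, sq]
  rw [hsum]
  refine .of_dotProduct_mulVec_pos (Matrix.isHermitian_one.sub (isHermitian_real_smul hPH _))
    fun v hv => ?_
  have hv0 : 0 < v ⬝ᵥ v := by
    have := Matrix.dotProduct_star_self_pos_iff.2 hv
    simpa using this
  rw [star_trivial, Matrix.sub_mulVec, Matrix.one_mulVec, Matrix.smul_mulVec, dotProduct_sub,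
    dotProduct_smul, smul_eq_mul, sub_pos]
  have h1 := dotProduct_mulVec_le P v
  have h2 : (C + 1)⁻¹ ^ 2 * C < 1 := by
    rw [inv_pow, inv_mul_lt_iff₀ (by positivity)]
    nlinarith
  calc (C + 1)⁻¹ ^ 2 * (v ⬝ᵥ (P *ᵥ v)) ≤ (C + 1)⁻¹ ^ 2 * (C * (v ⬝ᵥ v)) := by gcongr
    _ = (C + 1)⁻¹ ^ 2 * C * (v ⬝ᵥ v) := by ring
    _ < 1 * (v ⬝ᵥ v) := by gcongr
    _ = v ⬝ᵥ v := one_mul _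

/-- Second differences at tuples indexed by a finite type reduce to those at tuples indexed by
`Fin n`. -/
lemma SecondDiffNonneg.of_equiv {σ ι κ : Type} [Fintype ι] [DecidableEq ι] [Fintype κ]
    [DecidableEq κ] (e : ι ≃ κ) {q : Poly σ} {T : Set σ} {Y : σ → Matrix ι ι ℝ}
    (h : SecondDiffNonneg q T fun i => (Y i).submatrix e.symm e.symm) :
    SecondDiffNonneg q T Y := by
  intro H hH hT
  obtain ⟨δ, hδ, hpos⟩ := h (fun i => (H i).submatrix e.symm e.symm)
    (fun i => (hH i).submatrix _) fun i hi => by simp [hT i hi]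
  refine ⟨δ, hδ, fun r h0 hr => ?_⟩
  have hval (r : ℝ) : ev (fun i => (Y i).submatrix e.symm e.symm +
      r • (H i).submatrix e.symm e.symm) q =
        (ev (fun i => Y i + r • H i) q).submatrix e.symm e.symm :=
    ev_reindex e (fun i => Y i + r • H i) q
  have h1 := hpos r h0 hr
  rw [hval, hval, ev_reindex] at h1
  exact (Matrix.posSemidef_submatrix_equiv e.symm).1 h1

/-- Midpoint convexity at `X ± r K`. Only the letters `a` are rescaled, to bring them into the ball;
the directions do not move them, so any `r` is admissible. -/
lemma locallyConvex_of_convexInXOnBall (h : ConvexInXOnBall p) :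
    LocallyConvex p {i | Sum.isRight i} {i | Sum.isRight i} := by
  intro ι _ _ Y hY
  set e := Fintype.equivFin ι
  set n := Fintype.card ι
  set A : Tuple (Fin g) n := fun j => (Y (Sum.inl j)).submatrix e.symm e.symm
  set X : Tuple (Fin g) n := fun j => (Y (Sum.inr j)).submatrix e.symm e.symm
  have hA : A ∈ symTuples g n := fun j => (hY _).submatrix _
  have hX : X ∈ symTuples g n := fun j => (hY _).submatrix _
  obtain ⟨s, hs, hsA⟩ := exists_smul_mem_unitBall hA
  refine ⟨Sum.elim (fun _ => s) fun _ => 1, ?_, ?_, .of_equiv e ?_⟩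
  · rintro (i | i) <;> simp [hs]
  · rintro (i | i) hi <;> simp at hi ⊢
  · intro H hH hT
    refine ⟨1, one_pos, fun r _ _ => ?_⟩
    set K : Tuple (Fin g) n := fun j => H (Sum.inr j)
    have hK : K ∈ symTuples g n := fun j => hH _
    have hT' (j : Fin g) : H (Sum.inl j) = 0 := hT _ (by simp)
    have h1 := h n (s • A) hsA (X + r • K) (fun j => (hX j).add ((hK j).smul r)) (X + (-r) • K)
      (fun j => (hX j).add ((hK j).smul (-r))) (1 / 2) (by norm_num) (by norm_num)
    have h2 := h1.smul (show (0 : ℝ) ≤ 2 by norm_num)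
    have hmid : (1 / 2 : ℝ) • (X + r • K) + (1 - 1 / 2 : ℝ) • (X + (-r) • K) = X := by
      module
    rw [hmid] at h2
    have hval (r : ℝ) : evalAX p (s • A) (X + r • K) =
        ev (fun i => (Sum.elim (fun _ => s) (fun _ => 1) i • Y i).submatrix e.symm e.symm +
          r • H i) p := by
      rw [evalAX, eval_eq_ev]
      congr 2
      funext i
      rcases i with i | i
      · simp [hT', A]
        rfl
      · simp [X, K]
    have h0 := hval 0
    simp only [zero_smul, add_zero] at h0
    rw [hval r, hval (-r), h0] at h2
    convert! h2 using 1
    module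

/-- Concavity is global, so no rescaling is needed; the letters `x` form `U` because scalar values
of `x` are substituted later. -/
lemma locallyConvex_of_concaveInA (h : ConcaveInA p) :
    LocallyConvex (-p) {i | Sum.isLeft i} {i | Sum.isRight i} := by
  intro ι _ _ Y hY
  set e := Fintype.equivFin ι
  set n := Fintype.card ι
  set A : Tuple (Fin g) n := fun j => (Y (Sum.inl j)).submatrix e.symm e.symm
  set X : Tuple (Fin g) n := fun j => (Y (Sum.inr j)).submatrix e.symm e.symm
  have hA : A ∈ symTuples g n := fun j => (hY _).submatrix _
  have hX : X ∈ symTuples g n := fun j => (hY _).submatrix _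
  refine ⟨fun _ => 1, by simp, by simp, .of_equiv e ?_⟩
  intro H hH hT
  refine ⟨1, one_pos, fun r _ _ => ?_⟩
  set K : Tuple (Fin g) n := fun j => H (Sum.inl j)
  have hK : K ∈ symTuples g n := fun j => hH _
  have hT' (j : Fin g) : H (Sum.inr j) = 0 := hT _ (by simp)
  have h1 := h n (A + r • K) (fun j => (hA j).add ((hK j).smul r)) (A + (-r) • K)
    (fun j => (hA j).add ((hK j).smul (-r))) X hX (1 / 2) (by norm_num) (by norm_num)
  have h2 := h1.smul (show (0 : ℝ) ≤ 2 by norm_num)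
  have hmid : (1 / 2 : ℝ) • (A + r • K) + (1 - 1 / 2 : ℝ) • (A + (-r) • K) = A := by
    module
  rw [hmid] at h2
  have hval (r : ℝ) : evalAX p (A + r • K) X =
      ev (fun i => ((1 : ℝ) • Y i).submatrix e.symm e.symm + r • H i) p := by
    rw [evalAX, eval_eq_ev]
    congr 2
    funext i
    rcases i with i | i
    · simp [A, K]
    · simp [X, hT']
  have h0 := hval 0
  simp only [zero_smul, add_zero] at h0
  rw [hval r, hval (-r), h0] at h2
  convert! h2 using 1
  simp only [map_neg]
  module

end Hypotheses

/-! ### Positivity of the representing matrix -/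

section Positivity

variable {g n : ℕ}

/-- The symmetrized rank-one map `w uᵀ + u wᵀ`, divided by `u ⬝ᵥ u`, has the right value at `u` up
to a multiple of `u`, which the `u uᵀ` term removes. -/
lemma exists_symm_mulVec_eq {u : Fin n → ℝ} (hu : u ≠ 0) (w : Fin n → ℝ) :
    ∃ X : Matrix (Fin n) (Fin n) ℝ, X.IsSymm ∧ X *ᵥ u = w := by
  have hc : u ⬝ᵥ u ≠ 0 := fun h => hu (dotProduct_self_eq_zero.1 h)
  set c := u ⬝ᵥ u with hc'
  refine ⟨c⁻¹ • (Matrix.vecMulVec w u + Matrix.vecMulVec u w) -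
    (c⁻¹ ^ 2 * (w ⬝ᵥ u)) • Matrix.vecMulVec u u, ?_, ?_⟩
  · refine Matrix.IsSymm.sub (Matrix.IsSymm.smul ?_ _) (Matrix.IsSymm.smul ?_ _)
    · rw [Matrix.IsSymm, Matrix.transpose_add, Matrix.transpose_vecMulVec,
        Matrix.transpose_vecMulVec, add_comm]
    · rw [Matrix.IsSymm, Matrix.transpose_vecMulVec]
  · funext i
    simp only [Matrix.sub_mulVec, Matrix.smul_mulVec, Matrix.add_mulVec, Matrix.vecMulVec_mulVec,
      Pi.sub_apply, Pi.smul_apply, Pi.add_apply, ← hc', smul_eq_mul, MulOpposite.smul_eq_mul_unop,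
      MulOpposite.unop_op]
    field_simp
    ring

/-- Positivity of `W(x)ᵀ M W(x)` forces positivity of `M`. -/
lemma posSemidef_evalMat_of_sandwich {M : Matrix (Fin (g + 1)) (Fin (g + 1)) (Poly (Fin g))}
    (hM : M.IsHermitian) {A : Tuple (Fin g) n} (hA : A ∈ symTuples g n)
    (h : ∀ X ∈ symTuples g n, (evalAX (sandwich M) A X).PosSemidef) :
    (evalMat M A).PosSemidef := by
  refine .of_dotProduct_mulVec_nonneg (evalMat_isHermitian hM hA) fun v => ?_
  rw [star_trivial]
  set N := evalMat M A
  have hpos (v : Fin (g + 1) × Fin n → ℝ) (hv : (fun a => v (0, a)) ≠ 0) :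
      0 ≤ v ⬝ᵥ (N *ᵥ v) := by
    choose X hX hXv using fun j : Fin g => exists_symm_mulVec_eq hv fun a => v (j.succ, a)
    have h1 := (h X hX).dotProduct_mulVec_nonneg fun a => v (0, a)
    rw [star_trivial, dotProduct_sandwich M hA hX] at h1
    have h2 : stack X (fun a => v (0, a)) = v := by
      funext ⟨i, a⟩
      refine Fin.cases rfl (fun j => ?_) i
      exact congrFun (hXv j) a
    rwa [h2] at h1
  by_cases hv : (fun a => v (0, a)) = 0
  · rcases n with _ | n
    · have : v = 0 := by
        funext ⟨_, a⟩
        exact a.elim0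
      simp [this]
    -- Adding `r • w` makes the first block nonzero, so the vector has the form `W(X) u`; then `r →
    -- 0`.
    set w : Fin (g + 1) × Fin (n + 1) → ℝ := fun i => if i.1 = 0 then 1 else 0
    have key (r : ℝ) (hr : 0 < r) :
        0 ≤ v ⬝ᵥ (N *ᵥ v) + r * (v ⬝ᵥ (N *ᵥ w) + w ⬝ᵥ (N *ᵥ v)) + r ^ 2 * (w ⬝ᵥ (N *ᵥ w)) := by
      have := hpos (v + r • w) fun h0 => by
        have h1 := congrFun h0 0
        have h2 := congrFun hv 0
        simp only [Pi.zero_apply] at h2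
        simp [w, h2, hr.ne'] at h1
      simp only [Matrix.mulVec_add, Matrix.mulVec_smul, dotProduct_add, add_dotProduct,
        smul_dotProduct, dotProduct_smul, smul_eq_mul] at this
      linarith
    have hlim : Filter.Tendsto (fun r : ℝ => v ⬝ᵥ (N *ᵥ v) +
        r * (v ⬝ᵥ (N *ᵥ w) + w ⬝ᵥ (N *ᵥ v)) + r ^ 2 * (w ⬝ᵥ (N *ᵥ w)))
        (nhdsWithin 0 (Set.Ioi 0)) (nhds (v ⬝ᵥ (N *ᵥ v))) := by
      have : Continuous fun r : ℝ => v ⬝ᵥ (N *ᵥ v) +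
        r * (v ⬝ᵥ (N *ᵥ w) + w ⬝ᵥ (N *ᵥ v)) + r ^ 2 * (w ⬝ᵥ (N *ᵥ w)) := by fun_prop
      simpa using (this.tendsto 0).mono_left nhdsWithin_le_nhds
    refine ge_of_tendsto hlim ?_
    filter_upwards [self_mem_nhdsWithin] with r hr using key r hr
  · exact hpos v hv

end Positivity

/-! ### Construction of `R` and `Q` -/

section Construction

variable {g : ℕ} {p : PolyAX g}

/-- The coefficient of `W_α m(a) W_β`. -/
noncomputable def coeffW (p : PolyAX g) (α β : Fin (g + 1)) (m : List (Fin g)) : ℝ :=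
  coeff p (letterW α ++ (m.map Sum.inl ++ letterW β))

lemma reverse_letterW (α : Fin (g + 1)) : (letterW α).reverse = letterW α := by
  refine Fin.cases rfl (fun i => rfl) α

lemma coeffW_reverse (hp : IsSelfAdjoint p) (α β : Fin (g + 1)) (m : List (Fin g)) :
    coeffW p β α m.reverse = coeffW p α β m := by
  rw [coeffW, ← coeff_reverse hp]
  simp [coeffW, reverse_letterW]

/-- The words `x_i` occur in two entries of the matrix, with equal weights. -/
noncomputable def weight (α β : Fin (g + 1)) : ℝ := if α = 0 ↔ β = 0 then 1 else 1 / 2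

/-- The part of degree at most one in `a` of the matrix that represents `p`. -/
noncomputable def matR (p : PolyAX g) : Matrix (Fin (g + 1)) (Fin (g + 1)) (Poly (Fin g)) :=
  Matrix.of fun α β => (weight α β * coeffW p α β []) • word [] +
    ∑ k, coeffW p α β [k] • word [k]

/-- Minus the part of degree two in `a` of the matrix that represents `p`. -/
noncomputable def matQ (p : PolyAX g) : Matrix (Fin (g + 1)) (Fin (g + 1)) (Poly (Fin g)) :=
  Matrix.of fun α β => -∑ k, ∑ l, coeffW p α β [k, l] • word [k, l]

lemma matR_isHermitian (hp : IsSelfAdjoint p) : (matR p).IsHermitian := by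
  refine Matrix.IsHermitian.ext fun α β => ?_
  have hw : weight β α = weight α β := by simp [weight, iff_comm]
  simp only [matR, Matrix.of_apply, star_add, star_sum, star_real_smul, star_word, hw]
  rw [← coeffW_reverse hp β α []]
  refine congrArg₂ _ rfl (Finset.sum_congr rfl fun k _ => ?_)
  rw [← coeffW_reverse hp β α [k]]
  rfl

lemma matQ_isHermitian (hp : IsSelfAdjoint p) : (matQ p).IsHermitian := by
  refine Matrix.IsHermitian.ext fun α β => ?_
  simp only [matQ, Matrix.of_apply, star_neg, star_sum, star_real_smul, star_word]
  rw [Finset.sum_comm]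
  refine congrArg _ (Finset.sum_congr rfl fun k _ => Finset.sum_congr rfl fun l _ => ?_)
  rw [← coeffW_reverse hp β α [l, k]]
  rfl

lemma degreeLE_matR (α β : Fin (g + 1)) : DegreeLE 1 (matR p α β) := by
  have h (m : List (Fin g)) (hm : m.length ≤ 1) : DegreeLE 1 (word m) :=
    Submodule.subset_span ⟨m, hm, rfl⟩
  exact Submodule.add_mem _ (Submodule.smul_mem _ _ (h [] (by simp)))
    (Submodule.sum_mem _ fun k _ => Submodule.smul_mem _ _ (h [k] (by simp)))

lemma homogeneous_matQ (α β : Fin (g + 1)) : Homogeneous 2 (matQ p α β) := by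
  have h (k l : Fin g) : Homogeneous 2 (word [k, l]) :=
    Submodule.subset_span ⟨[k, l], rfl, rfl⟩
  exact Submodule.neg_mem _ (Submodule.sum_mem _ fun k _ => Submodule.sum_mem _ fun l _ =>
    Submodule.smul_mem _ _ (h k l))

lemma W_eq_word (α : Fin (g + 1)) : W g α = word (letterW α) := by
  refine Fin.cases ?_ (fun i => ?_) α
  · simp [W, letterW]
  · simp [W, letterW]

lemma ofA_word (m : List (Fin g)) : ofA g (word m) = word (m.map Sum.inl) := by
  induction m with
  | nil => simp
  | cons i m ih =>
    rw [word_cons, map_mul, ih, List.map_cons, word_cons]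
    simp [ofA]

lemma W_mul_ofA_mul_W (α β : Fin (g + 1)) (m : List (Fin g)) :
    star (W g α) * ofA g (word m) * W g β = word (letterW α ++ (m.map Sum.inl ++ letterW β)) := by
  rw [star_W, W_eq_word, W_eq_word, ofA_word, word_append, word_append, mul_assoc]

lemma sandwich_matR_sub_matQ (p : PolyAX g) : sandwich (matR p - matQ p) = ∑ α, ∑ β,
    ((weight α β * coeffW p α β []) • word (letterW α ++ (([] : List (Fin g)).map Sum.inl ++
        letterW β)) +
      ∑ k, coeffW p α β [k] • word (letterW α ++ ([k].map Sum.inl ++ letterW β)) +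
      ∑ k, ∑ l, coeffW p α β [k, l] • word (letterW α ++ ([k, l].map Sum.inl ++ letterW β))) := by
  refine Finset.sum_congr rfl fun α _ => Finset.sum_congr rfl fun β _ => ?_
  simp only [← W_mul_ofA_mul_W, matR, matQ, Matrix.sub_apply, Matrix.of_apply, sub_neg_eq_add,
    map_add, map_sum, map_smul, mul_add, add_mul, Finset.mul_sum, Finset.sum_mul,
    mul_smul_comm, smul_mul_assoc]

lemma coeff_sandwich_eq (p : PolyAX g) (w : List (Fin g ⊕ Fin g)) :
    coeff (sandwich (matR p - matQ p)) w = coeff p w * ∑ α, ∑ β,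
      ((weight α β * if letterW α ++ (([] : List (Fin g)).map Sum.inl ++ letterW β) = w
          then 1 else 0) +
        (∑ k, if letterW α ++ ([k].map Sum.inl ++ letterW β) = w then 1 else 0) +
        ∑ k, ∑ l, if letterW α ++ ([k, l].map Sum.inl ++ letterW β) = w then 1 else 0) := by
  have h (α β : Fin (g + 1)) (m : List (Fin g)) :
      coeffW p α β m * (if letterW α ++ (m.map Sum.inl ++ letterW β) = w then 1 else 0) =
        coeff p w * if letterW α ++ (m.map Sum.inl ++ letterW β) = w then 1 else 0 := by
    split_ifs with h
    · rw [← h, coeffW]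
    · simp
  rw [sandwich_matR_sub_matQ]
  simp only [coeff_sum, coeff_add, coeff_smul, coeff_word, mul_assoc, h, Finset.mul_sum, mul_add,
    mul_left_comm (coeff p w)]

/-- The factorization `W_α m W_β` is unique except for `x_i = x_i · 1 = 1 · x_i`, whose two
occurrences have weight one half each. -/
lemma multiplicity_eq_one (α β : Fin (g + 1)) (m : List (Fin g)) (hm : m.length ≤ 2) :
    ∑ α', ∑ β',
      ((weight α' β' * if letterW α' ++ (([] : List (Fin g)).map Sum.inl ++ letterW β') =
            letterW α ++ (m.map Sum.inl ++ letterW β) then 1 else 0) +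
        (∑ k, if letterW α' ++ ([k].map Sum.inl ++ letterW β') =
          letterW α ++ (m.map Sum.inl ++ letterW β) then 1 else 0) +
        ∑ k, ∑ l, if letterW α' ++ ([k, l].map Sum.inl ++ letterW β') =
          letterW α ++ (m.map Sum.inl ++ letterW β) then 1 else 0) = (1 : ℝ) := by
  rcases m with _ | ⟨a, _ | ⟨b, _ | ⟨c, m⟩⟩⟩
  · refine Fin.cases ?_ (fun i => ?_) α <;> refine Fin.cases ?_ (fun j => ?_) β <;>
      simp [Fin.sum_univ_succ, letterW, weight, ite_and, Fin.succ_ne_zero, -Finset.sum_boole]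
    all_goals norm_num
  · refine Fin.cases ?_ (fun i => ?_) α <;> refine Fin.cases ?_ (fun j => ?_) β <;>
      simp [Fin.sum_univ_succ, letterW, weight, ite_and, Fin.succ_ne_zero, -Finset.sum_boole]
  · refine Fin.cases ?_ (fun i => ?_) α <;> refine Fin.cases ?_ (fun j => ?_) β <;>
      simp [Fin.sum_univ_succ, letterW, weight, ite_and, Fin.succ_ne_zero, -Finset.sum_boole]
  · simp at hm

variable (hp : IsSelfAdjoint p)
  (hx : LocallyConvex p {i | Sum.isRight i} {i | Sum.isRight i})
  (ha : LocallyConvex (-p) {i | Sum.isLeft i} {i | Sum.isRight i})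

include hp hx ha in
theorem eq_sandwich : p = sandwich (matR p - matQ p) := by
  refine ext_coeff fun w => ?_
  rw [coeff_sandwich_eq]
  by_cases hw : coeff p w = 0
  · rw [hw, zero_mul]
  · obtain ⟨α, β, m, hm, rfl⟩ := exists_eq_letterW_append hp hx ha hw
    rw [multiplicity_eq_one α β m hm, mul_one]

-- This is the constant term of the `a`-middle matrix of `-p`, restricted to border words `1` and
-- `x_i`.
include hp ha in
lemma posSemidef_coeff : (Matrix.of fun a b : Fin g × Fin (g + 1) =>
    -coeffW p a.2 b.2 [a.1, b.1]).PosSemidef := by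
  refine .of_dotProduct_mulVec_nonneg (Matrix.IsHermitian.ext fun a b => ?_) fun θ => ?_
  · simp only [Matrix.of_apply, star_trivial]
    rw [← coeffW_reverse hp a.2 b.2]
    rfl
  · have := ha.sum_coeff_nonneg (fun a : Fin g × Fin (g + 1) => Sum.inl a.1) (fun _ => rfl)
      (fun a => letterW a.2) θ
    refine this.trans_eq ?_
    simp only [star_trivial, dotProduct, Matrix.mulVec, Matrix.of_apply, Finset.mul_sum,
      coeff_neg, reverse_letterW, coeffW]
    refine Finset.sum_congr rfl fun a _ => Finset.sum_congr rfl fun b _ => ?_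
    simp only [List.map_cons, List.map_nil, List.cons_append, List.nil_append]
    ring

open scoped MatrixOrder in
lemma exists_eq_conjTranspose_mul_self {ι : Type} [Fintype ι] [DecidableEq ι] {M : Matrix ι ι ℝ}
    (hM : M.PosSemidef) : ∃ B : Matrix ι ι ℝ, M = Bᴴ * B :=
  CStarAlgebra.nonneg_iff_eq_star_mul_self.1 hM.nonneg

include hp ha in
theorem isSumOfSquares_matQ : IsSumOfSquares (matQ p) := by
  obtain ⟨B, hB⟩ := exists_eq_conjTranspose_mul_self (posSemidef_coeff hp ha)
  have hB' (α β : Fin (g + 1)) (k l : Fin g) :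
      -coeffW p α β [k, l] = ∑ r, B r (k, α) * B r (l, β) := by
    have := congrFun (congrFun hB (k, α)) (l, β)
    simpa [Matrix.mul_apply] using this
  -- A factorization `Bᴴ * B` of the Gram matrix turns into linear forms `∑ₖ B_{r,(k,α)} a_k`, one
  -- row for each row of `B`.
  refine ⟨g * (g + 1), Matrix.of fun r α => ∑ k, B (finProdFinEquiv.symm r) (k, α) • word [k], ?_⟩
  ext1 α β
  simp only [matQ, Matrix.of_apply, Matrix.mul_apply, Matrix.conjTranspose_apply, star_sum,
    star_real_smul, star_word, List.reverse_singleton]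
  rw [Equiv.sum_comp finProdFinEquiv.symm fun r =>
    (∑ k, B r (k, α) • word [k]) * ∑ k, B r (k, β) • word [k]]
  simp only [Finset.sum_mul_sum, ← Finset.sum_neg_distrib, ← neg_smul, hB', Finset.sum_smul,
    smul_mul_smul_comm, ← word_append, List.singleton_append]
  exact (Finset.sum_comm.trans (Finset.sum_congr rfl fun k _ => Finset.sum_comm)).symm

lemma IsSumOfSquares.posSemidef_evalMat {k n : ℕ} {Q : Matrix (Fin k) (Fin k) (Poly (Fin g))}
    (hQ : IsSumOfSquares Q) {A : Tuple (Fin g) n} (hA : A ∈ symTuples g n) :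
    (evalMat Q A).PosSemidef := by
  obtain ⟨N, S, rfl⟩ := hQ
  have : evalMat (Sᴴ * S) A =
      (Matrix.of fun (i : Fin N × Fin n) (j : Fin k × Fin n) => eval A (S i.1 j.1) i.2 j.2)ᴴ *
        Matrix.of fun (i : Fin N × Fin n) (j : Fin k × Fin n) => eval A (S i.1 j.1) i.2 j.2 := by
    ext ⟨i, a⟩ ⟨j, b⟩
    simp only [evalMat_apply, Matrix.mul_apply, Matrix.conjTranspose_apply, map_sum, map_mul,
      Matrix.sum_apply, Fintype.sum_prod_type, Matrix.of_apply, star_trivial]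
    simp only [eval_eq_ev, ← transpose_ev hA, Matrix.transpose_apply]
  rw [this]
  exact Matrix.posSemidef_conjTranspose_mul_self _

theorem exists_isRepresentation (hp : IsSelfAdjoint p) (h₁ : ConvexInXOnBall p)
    (h₂ : NonnegOnBall p) (h₃ : ConcaveInA p) :
    ∃ R Q : Matrix (Fin (g + 1)) (Fin (g + 1)) (Poly (Fin g)),
      IsRepresentation p R Q ∧ IsSumOfSquares Q := by
  have hx := locallyConvex_of_convexInXOnBall h₁
  have ha := locallyConvex_of_concaveInA h₃
  have hQ := isSumOfSquares_matQ hp ha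
  refine ⟨matR p, matQ p, ⟨eq_sandwich hp hx ha, matR_isHermitian hp, matQ_isHermitian hp,
    degreeLE_matR, homogeneous_matQ, fun n A hA => hQ.posSemidef_evalMat hA,
    fun n A hA => ?_⟩, hQ⟩
  rw [← evalMat_sub]
  refine posSemidef_evalMat_of_sandwich ((matR_isHermitian hp).sub (matQ_isHermitian hp)) hA.1
    fun X hX => ?_
  rw [← eq_sandwich hp hx ha]
  exact h₂ n A hA X hX

end Construction

end NCPoly

theorem mainTheorem6 (g : ℕ) (p : NCPoly.PolyAX g) (hp : IsSelfAdjoint p) :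
    (NCPoly.ConvexInXOnBall p → NCPoly.NonnegOnBall p → NCPoly.ConcaveInA p →
      ∃ R Q : Matrix (Fin (g + 1)) (Fin (g + 1)) (NCPoly.Poly (Fin g)),
        NCPoly.IsRepresentation p R Q ∧ NCPoly.IsSumOfSquares Q) ∧
    (∀ R Q : Matrix (Fin (g + 1)) (Fin (g + 1)) (NCPoly.Poly (Fin g)),
      NCPoly.IsRepresentation p R Q →
        NCPoly.ConvexInXOnBall p ∧ NCPoly.NonnegOnBall p ∧ NCPoly.ConcaveInA p) :=
  ⟨NCPoly.exists_isRepresentation hp, fun _ _ h =>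
    ⟨h.convexInXOnBall hp, h.nonnegOnBall hp, h.concaveInA hp⟩⟩
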